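/- **Semi-decidability of may/must statistical termination.** *Setting.* Fix sets $A$ (atomic programs), $B$ (conditions) and $S$ (states), each effectively encoded by natural numbers. For a set $X$ let $V_{=1,\omega}(X)$ be the set of finite linear combinations $\sum_i r_i\cdot x_i$ of point masses ($r_i\in\mathbb R_{\ge 0}$, $x_i\in X$) of total mass $1$. Each $a\in A$ is interpreted by $[\![a]\!]:S\to V_{=1,\omega}(S)$, each $b\in B$ by $[\![b]\!]:S\to\{\mathtt{tt},\mathtt{ff}\}$. Programs are $$P::=\mathtt{skip}\mid a\mid P;P\mid P\parallel P\mid P+_pP\mid P+P\mid \mathtt{if}\ b\ \mathtt{then}\ P\ \mathtt{else}\ P\mid\mathtt{while}\ b\ P\qquad(p\in[0,1]\cap\mathbb Q),$$ and configurations are pairs $\langle P,s\rangle$. The small-step relation $\langle P,s\rangle\to\nu$, with $\nu\in V_{=1,\omega}(S+\text{configurations})$, is generated as follows. $\langle\mathtt{skip},s\rangle\to 1\cdot s$ and $\langle a,s\rangle\to[\![a]\!](s)$. If $\langle P,s\rangle\to\sum_i p_i\cdot\langle P_i,s_i\rangle+\sum_j p_j\cdot s_j$, then $\langle P;Q,s\rangle\to\sum_i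 p_i\cdot\langle P_i;Q,s_i\rangle+\sum_j p_j\cdot\langle Q,s_j\rangle$, and likewise for $P\parallel Q$ (with $P_i\parallel Q$ in place of $P_i;Q$) and, symmetrically, for a step of $Q$ in $P\parallel Q$. If $\langle P,s\rangle\to\mu$ and $\langle Q,s\rangle\to\nu$, then $\langle P+_pQ,s\rangle\to p\cdot\mu+(1-p)\cdot\nu$. $P+Q$ has the steps of $P$ and those of $Q$. A conditional steps to $1\cdot\langle P,s\rangle$ or $1\cdot\langle Q,s\rangle$, where the branch is given by $[\![b]\!](s)$. $\mathtt{while}\ b\ P$ steps to $1\cdot\langle P;\mathtt{while}\ b\ P,s\rangle$ if $[\![b]\!](s)=\mathtt{tt}$, and to $1\cdot s$ otherwise. A *scheduler* $\mathcal S$ is a partial function sending a history $h$ (a finite list of pairs of a configuration and a valuation in $V_{=1,\omega}(S+\text{configurations})$) and a configuration $c$ to a finitely supported probability distribution over $\{\nu\mid c\to\nu\}$. Put $hc\Downarrow^{\mathcal S,0}\bot$, where $\bot$ is the zero valuation; and if $\mathcal S(h,c)=\sum_kp_k\cdot\nu_k$, $\nu_k=\sum_ip_{k,i}\cdot c_{k,i}+\sum_jp_{k,j}\cdot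 s_{k,j}$ (distinct points, nonzero coefficients) and $hc\nu_kc_{k,i}\Downarrow^{\mathcal S,n}\mu_{k,i}$ for all $k,i$, then $hc\Downarrow^{\mathcal S,n+1}\sum_kp_k\cdot(\sum_ip_{k,i}\cdot\mu_{k,i}+\sum_jp_{k,j}\cdot s_{k,j})$. For a set $\varphi$ of valuations on $S$, $c\models\Diamond\varphi$ means that $c\Downarrow^{\mathcal S,n}\mu$ (with empty history) for some scheduler $\mathcal S$, some $n$ and some $\mu\in\varphi$; $c\models\Box\varphi$ means that for every scheduler $\mathcal S$ that is non-blocking for $c$ (for every $n$ there is $\mu$ with $c\Downarrow^{\mathcal S,n}\mu$) there are $n$ and $\mu\in\varphi$ with $c\Downarrow^{\mathcal S,n}\mu$. The formula $(>p)U$ denotes $\{\mu\mid\mu(U)>p\}$; $\vee$ and $\wedge$ denote union and intersection. Finally put $F_0(c)=\{\bot\}$ and $$F_{n+1}(c)=\bigcup\Big\{\textstyle\sum_ip_i\cdot F_n(c_i)+\sum_jp_j\cdot s_j\ \Big|\ c\to\sum_ip_i\cdot c_i+\sum_jp_j\cdot s_j\Big\}$$ (Minkowski sums; distinct points, nonzero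 coefficients). *Theorem.* Assume that every $[\![a]\!]$ is computable with rational weights (from $s$ one computes a list of states with nonnegative rational weights that represents $[\![a]\!](s)$), and that every $[\![b]\!]$ is computable. 1. *(Exhaustive search.)* For every configuration $c$, all $p_1,\dots,p_k\in\mathbb Q_{\ge0}$ and all $U_1,\dots,U_k\subseteq S$: $c\models\Diamond\big((>p_1)U_1\vee\dots\vee(>p_k)U_k\big)$ iff for some $n$ some $\mu\in F_n(c)$ satisfies $(>p_1)U_1\vee\dots\vee(>p_k)U_k$; and $c\models\Box\big((>p_1)U_1\wedge\dots\wedge(>p_k)U_k\big)$ iff for some $n$ all $\mu\in F_n(c)$ satisfy $(>p_1)U_1\wedge\dots\wedge(>p_k)U_k$. 2. For every program $P$, the set $F_n(\langle P,s\rangle)$ is finite, consists of valuations with rational weights, and can be computed as a list from $n$ and $s$. If $U\subseteq S$ is decidable, then $\langle P,s\rangle\models\Diamond(>p)U$ and $\langle P,s\rangle\models\Box(>p)U$ are semi-decidable in $(s,p)\in S\times\mathbb Q_{\ge0}$. If $U_1,\dots,U_k\subseteq S$ are decidable, then $\langle P,s\rangle\models\Diamond\big((>p_1)U_1\vee\dots\vee(>p_k)U_k\big)$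 and $\langle P,s\rangle\models\Box\big((>p_1)U_1\wedge\dots\wedge(>p_k)U_k\big)$ are semi-decidable in $(s,p_1,\dots,p_k)$. 3. Suppose moreover that $[\![a]\!](s)$ and $[\![b]\!](s)$ are computable uniformly in $(a,s)$ and $(b,s)$. Then $F_n(\langle P,s\rangle)$ is computable from $(n,P,s)$; and for every effectively encoded index set $I$ and every uniformly decidable family $(U_i)_{i\in I}$ of subsets of $S$, the statements $\langle P,s\rangle\models\Diamond(>p)U_i$ and $\langle P,s\rangle\models\Box(>p)U_i$ are semi-decidable in $(P,s,i,p)$, and $\langle P,s\rangle\models\Diamond\bigvee_{j=1}^{k}(>p_j)U_{i_j}$ and $\langle P,s\rangle\models\Box\bigwedge_{j=1}^{k}(>p_j)U_{i_j}$ are semi-decidable in $P$, $s$ and the finite list $(i_1,p_1),\dots,(i_k,p_k)$. -/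

import Mathlib

open scoped NNReal NNRat

/-! ### Effective encodings of rational numbers -/

namespace PGCL

theorem primrec_coprime : PrimrecPred fun x : ℕ × ℕ => 0 < x.2 ∧ x.1.Coprime x.2 := by
  have hR : PrimrecRel fun (d : ℕ) (x : ℕ × ℕ) => ¬(x.1 % d = 0 ∧ x.2 % d = 0) ∨ d = 1 := by
    refine PrimrecPred.or (PrimrecPred.not (PrimrecPred.and ?_ ?_)) ?_
    · exact Primrec.eq.comp (Primrec.nat_mod.comp (Primrec.fst.comp Primrec.snd) Primrec.fst)
        (Primrec.const 0)
    · exact Primrec.eq.comp (Primrec.nat_mod.comp (Primrec.snd.comp Primrec.snd) Primrec.fst)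
        (Primrec.const 0)
    · exact Primrec.eq.comp Primrec.fst (Primrec.const 1)
  have hB : Primrec fun x : ℕ × ℕ => x.1 + x.2 + 1 :=
    Primrec.succ.comp (Primrec.nat_add.comp Primrec.fst Primrec.snd)
  have hC := hR.forall_mem_list.comp (Primrec.list_range.comp hB) (Primrec.id (α := ℕ × ℕ))
  refine (PrimrecPred.and (Primrec.nat_lt.comp (Primrec.const 0) Primrec.snd) hC).of_eq ?_
  rintro ⟨a, b⟩
  simp only [id, and_congr_right_iff, List.mem_range]
  intro hb
  constructor
  · intro h
    have hg : Nat.gcd a b < a + b + 1 :=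
      Nat.lt_succ_of_le ((Nat.le_of_dvd hb (Nat.gcd_dvd_right a b)).trans (Nat.le_add_left b a))
    rcases h _ hg with h | h
    · exact absurd ⟨Nat.mod_eq_zero_of_dvd (Nat.gcd_dvd_left a b),
        Nat.mod_eq_zero_of_dvd (Nat.gcd_dvd_right a b)⟩ h
    · exact h
  · intro h d _
    by_cases hd : a % d = 0 ∧ b % d = 0
    · right
      have := Nat.dvd_gcd (Nat.dvd_of_mod_eq_zero hd.1) (Nat.dvd_of_mod_eq_zero hd.2)
      rw [h] at this
      exact Nat.dvd_one.1 this
    · exact Or.inl hd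

/-- A nonnegative rational is its reduced fraction. -/
def nnratEquiv : ℚ≥0 ≃ {x : ℕ × ℕ // 0 < x.2 ∧ x.1.Coprime x.2} where
  toFun q := ⟨(q.num, q.den), q.den_pos, q.coprime_num_den⟩
  invFun x := ⟨⟨x.1.1, x.1.2, x.2.1.ne', x.2.2⟩, by
    rw [← Rat.num_nonneg]; exact Int.natCast_nonneg _⟩
  left_inv _ := NNRat.ext_num_den rfl rfl
  right_inv _ := rfl

/-- Mathlib's encoding of a nonnegative rational, by the numerator and the denominator of its
reduced fraction, is primitive recursive. -/
instance instPrimcodableNNRat : Primcodable ℚ≥0 where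
  toEncodable := inferInstance
  prim := by
    let : Primcodable {x : ℕ × ℕ // 0 < x.2 ∧ x.1.Coprime x.2} :=
      Primcodable.subtype primrec_coprime
    refine (Primcodable.ofEquiv _ nnratEquiv).prim.of_eq fun n => ?_
    congr 1
    change (Encodable.decodeSubtype n).bind (some ∘ nnratEquiv.symm) =
      (Encodable.decodeSigma n).bind _
    have hl : (Encodable.decodeSubtype n : Option {x : ℕ × ℕ // 0 < x.2 ∧ x.1.Coprime x.2}) =
        if h : 0 < n.unpair.2 ∧ n.unpair.1.Coprime n.unpair.2 then
          some ⟨(n.unpair.1, n.unpair.2), h⟩ else none := rfl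
    have hr : (Encodable.decodeSigma n : Option (Σ k : ℕ, {d : ℕ // 0 < d ∧ k.Coprime d})) =
        (if h : 0 < n.unpair.2 ∧ n.unpair.1.Coprime n.unpair.2 then
          some ⟨n.unpair.2, h⟩ else none).map (Sigma.mk n.unpair.1) := rfl
    rw [hl, hr]
    split_ifs <;> rfl

theorem primrec_nnrat_parts : Primrec fun q : ℚ≥0 => (q.num, q.den) := by
  exact Primrec.encode_iff.1 (Primrec.encode.of_eq fun q => rfl)

theorem primrec_le_one : PrimrecPred fun q : ℚ≥0 => q ≤ 1 := by
  refine (Primrec.nat_le.comp (Primrec.fst.comp primrec_nnrat_parts)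
    (Primrec.snd.comp primrec_nnrat_parts)).of_eq fun q => ?_
  conv_rhs => rw [← NNRat.num_div_den q]
  rw [div_le_one (by exact_mod_cast q.den_pos)]
  exact_mod_cast Iff.rfl

/-- The rational probabilities, `[0,1] ∩ ℚ`. -/
abbrev RatProb := {p : ℚ≥0 // p ≤ 1}

instance instPrimcodableRatProb : Primcodable RatProb :=
  Primcodable.subtype primrec_le_one


/-! ### Programs -/

/-- Programs of concurrent pGCL over atomic programs `A` and conditions `B`. -/
inductive Prog (A : Type*) (B : Type*)
  | skip : Prog A B
  | atom (a : A) : Prog A B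
  | seq (P Q : Prog A B) : Prog A B
  | par (P Q : Prog A B) : Prog A B
  | choice (p : RatProb) (P Q : Prog A B) : Prog A B
  | nondet (P Q : Prog A B) : Prog A B
  | ite (b : B) (P Q : Prog A B) : Prog A B
  | whileDo (b : B) (P : Prog A B) : Prog A B

namespace Prog

open Encodable

variable {A B : Type*} [Primcodable A] [Primcodable B]

/-- The Gödel number of a program. -/
def code : Prog A B → ℕ
  | skip => Nat.pair 0 0 + 1
  | atom a => Nat.pair 1 (encode a) + 1
  | seq P Q => Nat.pair 2 (Nat.pair P.code Q.code) + 1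
  | par P Q => Nat.pair 3 (Nat.pair P.code Q.code) + 1
  | nondet P Q => Nat.pair 4 (Nat.pair P.code Q.code) + 1
  | choice p P Q => Nat.pair 5 (Nat.pair (encode p) (Nat.pair P.code Q.code)) + 1
  | ite b P Q => Nat.pair 6 (Nat.pair (encode b) (Nat.pair P.code Q.code)) + 1
  | whileDo b P => Nat.pair 7 (Nat.pair (encode b) P.code) + 1

/-- One step of decoding: from the decodings of smaller numbers (given by `r`), produce the
decoding of `n + 1`, for `n = Nat.pair k m`. -/
def decStep {X : Type*} (skip' : X) (atom' : A → X) (seq' par' nondet' : X → X → X)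
    (choice' : RatProb → X → X → X) (ite' : B → X → X → X) (while' : B → X → X)
    (k m : ℕ) (r : ℕ → Option X) : Option X :=
  if k = 0 then (if m = 0 then some skip' else none)
  else if k = 1 then (decode (α := A) m).map atom'
  else if k = 2 then (r m.unpair.1).bind fun P => (r m.unpair.2).map fun Q => seq' P Q
  else if k = 3 then (r m.unpair.1).bind fun P => (r m.unpair.2).map fun Q => par' P Q
  else if k = 4 then (r m.unpair.1).bind fun P => (r m.unpair.2).map fun Q => nondet' P Q
  else if k = 5 then (decode (α := RatProb) m.unpair.1).bind fun p =>
    (r m.unpair.2.unpair.1).bind fun P => (r m.unpair.2.unpair.2).map fun Q => choice' p P Q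
  else if k = 6 then (decode (α := B) m.unpair.1).bind fun b =>
    (r m.unpair.2.unpair.1).bind fun P => (r m.unpair.2.unpair.2).map fun Q => ite' b P Q
  else if k = 7 then (decode (α := B) m.unpair.1).bind fun b =>
    (r m.unpair.2).map fun P => while' b P
  else none

/-- Decoding of Gödel numbers. -/
def uncode : ℕ → Option (Prog A B)
  | 0 => none
  | n + 1 => decStep skip atom seq par nondet choice ite whileDo n.unpair.1 n.unpair.2
      (fun i => if _h : i ≤ n then uncode i else none)
  decreasing_by omega

theorem uncode_code (P : Prog A B) : uncode P.code = some P := by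
  induction P with
  | skip => simp [code, uncode, decStep]
  | atom a => simp [code, uncode, decStep]
  | seq P Q hP hQ | par P Q hP hQ | nondet P Q hP hQ =>
    have h1 : ∀ k, P.code ≤ Nat.pair k (Nat.pair P.code Q.code) := fun k =>
      (Nat.left_le_pair _ _).trans (Nat.right_le_pair _ _)
    have h2 : ∀ k, Q.code ≤ Nat.pair k (Nat.pair P.code Q.code) := fun k =>
      (Nat.right_le_pair _ _).trans (Nat.right_le_pair _ _)
    simp [code, uncode, decStep, h1, h2, hP, hQ]
  | choice p P Q hP hQ | ite p P Q hP hQ =>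
    have h1 : ∀ k, P.code ≤ Nat.pair k (Nat.pair (encode p) (Nat.pair P.code Q.code)) := fun k =>
      (Nat.left_le_pair _ _).trans ((Nat.right_le_pair _ _).trans (Nat.right_le_pair _ _))
    have h2 : ∀ k, Q.code ≤ Nat.pair k (Nat.pair (encode p) (Nat.pair P.code Q.code)) := fun k =>
      (Nat.right_le_pair _ _).trans ((Nat.right_le_pair _ _).trans (Nat.right_le_pair _ _))
    simp [code, uncode, decStep, h1, h2, hP, hQ]
  | whileDo b P hP =>
    have h1 : ∀ k, P.code ≤ Nat.pair k (Nat.pair (encode b) P.code) := fun k =>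
      (Nat.right_le_pair _ _).trans (Nat.right_le_pair _ _)
    simp [code, uncode, decStep, h1, hP]

theorem decStep_map (k m : ℕ) (r : ℕ → Option (Prog A B)) :
    (decStep skip atom seq par nondet choice ite whileDo k m r).map code =
      decStep (Nat.pair 0 0 + 1) (fun a : A => Nat.pair 1 (encode a) + 1)
        (fun x y => Nat.pair 2 (Nat.pair x y) + 1) (fun x y => Nat.pair 3 (Nat.pair x y) + 1)
        (fun x y => Nat.pair 4 (Nat.pair x y) + 1)
        (fun p x y => Nat.pair 5 (Nat.pair (encode p) (Nat.pair x y)) + 1)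
        (fun (b : B) x y => Nat.pair 6 (Nat.pair (encode b) (Nat.pair x y)) + 1)
        (fun (b : B) x => Nat.pair 7 (Nat.pair (encode b) x) + 1)
        k m (fun i => (r i).map code) := by
  unfold decStep
  rcases k with _ | _ | _ | _ | _ | _ | _ | _ | k <;>
    simp [Option.map_bind, Option.bind_map, Option.map_map, Function.comp_def, code]

/-- `decStep` on Gödel numbers, with the recursive calls read off a list. -/
def codeStep (A B : Type*) [Primcodable A] [Primcodable B] (L : List (Option ℕ)) : Option ℕ :=
  decStep (Nat.pair 0 0 + 1) (fun a : A => Nat.pair 1 (encode a) + 1)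
    (fun x y => Nat.pair 2 (Nat.pair x y) + 1) (fun x y => Nat.pair 3 (Nat.pair x y) + 1)
    (fun x y => Nat.pair 4 (Nat.pair x y) + 1)
    (fun p x y => Nat.pair 5 (Nat.pair (encode p) (Nat.pair x y)) + 1)
    (fun (b : B) x y => Nat.pair 6 (Nat.pair (encode b) (Nat.pair x y)) + 1)
    (fun (b : B) x => Nat.pair 7 (Nat.pair (encode b) x) + 1)
    (L.length - 1).unpair.1 (L.length - 1).unpair.2 (fun i => (L[i]?).bind id)

theorem primrec_lookup {i : List (Option ℕ) → ℕ} (hi : Primrec i) :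
    Primrec fun L : List (Option ℕ) => (L[i L]?).bind id :=
  Primrec.option_bind (Primrec.list_getElem?.comp Primrec.id hi) (Primrec.snd.to₂)

theorem primrec_binStep (c : ℕ) {i j : List (Option ℕ) → ℕ} (hi : Primrec i) (hj : Primrec j) :
    Primrec fun L : List (Option ℕ) => ((L[i L]?).bind id).bind fun x =>
      ((L[j L]?).bind id).map fun y => Nat.pair c (Nat.pair x y) + 1 := by
  refine Primrec.option_bind (primrec_lookup hi) ?_
  refine Primrec.option_map ((primrec_lookup hj).comp Primrec.fst) ?_
  exact Primrec.succ.comp (Primrec₂.natPair.comp (Primrec.const c)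
    (Primrec₂.natPair.comp (Primrec.snd.comp Primrec.fst) Primrec.snd))

theorem primrec_triStep (c : ℕ) (C : Type*) [Primcodable C] {h i j : List (Option ℕ) → ℕ}
    (hh : Primrec h) (hi : Primrec i) (hj : Primrec j) :
    Primrec fun L : List (Option ℕ) => (decode (α := C) (h L)).bind fun p =>
      ((L[i L]?).bind id).bind fun x => ((L[j L]?).bind id).map fun y =>
        Nat.pair c (Nat.pair (encode p) (Nat.pair x y)) + 1 := by
  refine Primrec.option_bind (Primrec.decode.comp hh) ?_
  refine Primrec.option_bind ((primrec_lookup hi).comp Primrec.fst) ?_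
  refine Primrec.option_map ((primrec_lookup hj).comp (Primrec.fst.comp Primrec.fst)) ?_
  exact Primrec.succ.comp (Primrec₂.natPair.comp (Primrec.const c)
    (Primrec₂.natPair.comp
      (Primrec.encode.comp (Primrec.snd.comp (Primrec.fst.comp Primrec.fst)))
      (Primrec₂.natPair.comp (Primrec.snd.comp Primrec.fst) Primrec.snd)))

theorem primrec_duoStep (c : ℕ) (C : Type*) [Primcodable C] {h i : List (Option ℕ) → ℕ}
    (hh : Primrec h) (hi : Primrec i) :
    Primrec fun L : List (Option ℕ) => (decode (α := C) (h L)).bind fun p =>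
      ((L[i L]?).bind id).map fun x => Nat.pair c (Nat.pair (encode p) x) + 1 := by
  refine Primrec.option_bind (Primrec.decode.comp hh) ?_
  refine Primrec.option_map ((primrec_lookup hi).comp Primrec.fst) ?_
  exact Primrec.succ.comp (Primrec₂.natPair.comp (Primrec.const c)
    (Primrec₂.natPair.comp (Primrec.encode.comp (Primrec.snd.comp Primrec.fst)) Primrec.snd))

theorem primrec_atomStep (c : ℕ) (C : Type*) [Primcodable C] {h : List (Option ℕ) → ℕ}
    (hh : Primrec h) :
    Primrec fun L : List (Option ℕ) => (decode (α := C) (h L)).map fun p =>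
      Nat.pair c (encode p) + 1 := by
  refine Primrec.option_map (Primrec.decode.comp hh) ?_
  exact Primrec.succ.comp (Primrec₂.natPair.comp (Primrec.const c)
    (Primrec.encode.comp Primrec.snd))

theorem primrec_codeStep : Primrec (codeStep A B) := by
  have hk : Primrec fun L : List (Option ℕ) => (L.length - 1).unpair.1 :=
    Primrec.fst.comp (Primrec.unpair.comp (Primrec.pred.comp Primrec.list_length))
  have hm : Primrec fun L : List (Option ℕ) => (L.length - 1).unpair.2 :=
    Primrec.snd.comp (Primrec.unpair.comp (Primrec.pred.comp Primrec.list_length))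
  have hm1 : Primrec fun L : List (Option ℕ) => (L.length - 1).unpair.2.unpair.1 :=
    Primrec.fst.comp (Primrec.unpair.comp hm)
  have hm2 : Primrec fun L : List (Option ℕ) => (L.length - 1).unpair.2.unpair.2 :=
    Primrec.snd.comp (Primrec.unpair.comp hm)
  have hm21 : Primrec fun L : List (Option ℕ) => (L.length - 1).unpair.2.unpair.2.unpair.1 :=
    Primrec.fst.comp (Primrec.unpair.comp hm2)
  have hm22 : Primrec fun L : List (Option ℕ) => (L.length - 1).unpair.2.unpair.2.unpair.2 :=
    Primrec.snd.comp (Primrec.unpair.comp hm2)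
  have hk' : ∀ c : ℕ, PrimrecPred fun L : List (Option ℕ) => (L.length - 1).unpair.1 = c :=
    fun c => Primrec.eq.comp hk (Primrec.const c)
  have hm0 : PrimrecPred fun L : List (Option ℕ) => (L.length - 1).unpair.2 = 0 :=
    Primrec.eq.comp hm (Primrec.const 0)
  have h7 := Primrec.ite (hk' 7) (primrec_duoStep 7 B hm1 hm2) (Primrec.const none)
  have h6 := Primrec.ite (hk' 6) (primrec_triStep 6 B hm1 hm21 hm22) h7
  have h5 := Primrec.ite (hk' 5) (primrec_triStep 5 RatProb hm1 hm21 hm22) h6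
  have h4 := Primrec.ite (hk' 4) (primrec_binStep 4 hm1 hm2) h5
  have h3 := Primrec.ite (hk' 3) (primrec_binStep 3 hm1 hm2) h4
  have h2 := Primrec.ite (hk' 2) (primrec_binStep 2 hm1 hm2) h3
  have h1 := Primrec.ite (hk' 1) (primrec_atomStep 1 A hm) h2
  have h0 := Primrec.ite (hk' 0)
    (Primrec.ite hm0 (Primrec.const (some (Nat.pair 0 0 + 1))) (Primrec.const none)) h1
  exact h0

theorem primrec_uncode : Primrec fun n => (uncode n : Option (Prog A B)).map code := by
  have key : Primrec₂ fun (_ : Unit) (n : ℕ) => (uncode n : Option (Prog A B)).map code := by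
    refine Primrec.nat_strong_rec (g := fun _ L =>
      if L.length = 0 then some none else some (codeStep A B L)) _ ?_ ?_
    · refine Primrec.ite (Primrec.eq.comp (Primrec.list_length.comp Primrec.snd)
        (Primrec.const 0)) (Primrec.const _) ?_
      exact Primrec.option_some.comp (primrec_codeStep.comp Primrec.snd)
    · rintro - (_ | n)
      · simp [uncode]
      · simp only [List.length_map, List.length_range, Nat.add_eq_zero_iff, one_ne_zero, and_false,
          if_false, Option.some.injEq]
        rw [uncode, decStep_map, codeStep]
        simp only [List.length_map, List.length_range, Nat.add_sub_cancel]
        congr 1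
        funext i
        by_cases h : i ≤ n
        · simp [h, Nat.lt_succ_of_le h]
        · simp [h, not_lt.2 (Nat.succ_le_of_lt (not_le.1 h))]
  exact key.comp (Primrec.const ()) Primrec.id

/-- Programs are coded by their Gödel numbers. -/
instance instPrimcodable : Primcodable (Prog A B) where
  encode := code
  decode := uncode
  encodek := uncode_code
  prim := by
    have h := Primrec.nat_iff.1 (Primrec.encode.comp (primrec_uncode (A := A) (B := B)))
    refine h.of_eq fun n => ?_
    rcases (uncode n : Option (Prog A B)) with _ | P <;> rfl

end Prog

/-! ### Finite valuations on a discrete space -/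

noncomputable section

/-- The total mass of a finite linear combination of point masses. -/
def total {X : Type*} (μ : X →₀ ℝ≥0) : ℝ≥0 := μ.sum fun _ r => r

/-- The value `μ(U)` of a finite linear combination `μ` of point masses. -/
def mass {X : Type*} (μ : X →₀ ℝ≥0) (U : Set X) : ℝ≥0 :=
  μ.sum fun x r => U.indicator (fun _ => r) x

/-- `V_{=1,ω}(X)` for a discrete `X`: the finite linear combinations of point masses (stored by
their coefficients) of total mass `1`. -/
abbrev PVal (X : Type*) := {μ : X →₀ ℝ≥0 // total μ = 1}

namespace PVal

/-- The point mass at `x`. -/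
def dirac {X : Type*} (x : X) : PVal X := ⟨Finsupp.single x 1, by simp [total]⟩

/-- The image `∑ pᵢ · f(xᵢ)` of `∑ pᵢ · xᵢ`. -/
def map {X Y : Type*} (f : X → Y) (μ : PVal X) : PVal Y :=
  ⟨Finsupp.mapDomain f μ.1, by
    have h := μ.2
    unfold total at h ⊢
    rw [Finsupp.sum_mapDomain_index (fun _ => rfl) (fun _ _ _ => rfl), h]⟩

/-- The convex combination `p · μ + (1 - p) · ν`. -/
def mix {X : Type*} (p : RatProb) (μ ν : PVal X) : PVal X :=
  ⟨((p.1 : ℚ≥0) : ℝ≥0) • μ.1 + (1 - ((p.1 : ℚ≥0) : ℝ≥0)) • ν.1, by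
    have hμ := μ.2
    have hν := ν.2
    have hp : ((p.1 : ℚ≥0) : ℝ≥0) ≤ 1 := by exact_mod_cast p.2
    unfold total at *
    rw [Finsupp.sum_add_index' (fun _ => rfl) (fun _ _ _ => rfl),
      Finsupp.sum_smul_index (fun _ => rfl), Finsupp.sum_smul_index (fun _ => rfl),
      ← Finsupp.mul_sum, ← Finsupp.mul_sum, hμ, hν, mul_one, mul_one, add_tsub_cancel_of_le hp]⟩

end PVal

/-! ### Operational semantics -/

/-- The interpretation of atomic programs and conditions on the states `S`. -/
structure Interp (A B S : Type*) where
  atom : A → S → PVal S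
  cond : B → S → Bool

/-- A configuration `⟨P, s⟩`. -/
abbrev Config (A B S : Type*) := Prog A B × S

/-- The result of one step: termination in a state, or a further configuration. -/
abbrev Outcome (A B S : Type*) := S ⊕ Config A B S

section Semantics

variable {A B S : Type*}

/-- Replace `⟨P', t⟩` by `⟨k P', t⟩`, and a final state `t` by `⟨Q, t⟩`. -/
def Outcome.continue (k : Prog A B → Prog A B) (Q : Prog A B) : Outcome A B S → Outcome A B S
  | .inl t => .inr (Q, t)
  | .inr (P', t) => .inr (k P', t)

/-- The small-step semantics `⟨P, s⟩ ⟶ ν`. -/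
inductive Step (I : Interp A B S) : Config A B S → PVal (Outcome A B S) → Prop
  | skip (s : S) : Step I (.skip, s) (PVal.dirac (.inl s))
  | atom (a : A) (s : S) : Step I (.atom a, s) ((I.atom a s).map .inl)
  | seq {P Q : Prog A B} {s : S} {ν : PVal (Outcome A B S)} (h : Step I (P, s) ν) :
      Step I (.seq P Q, s) (ν.map (Outcome.continue (fun P' => .seq P' Q) Q))
  | parLeft {P Q : Prog A B} {s : S} {ν : PVal (Outcome A B S)} (h : Step I (P, s) ν) :
      Step I (.par P Q, s) (ν.map (Outcome.continue (fun P' => .par P' Q) Q))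
  | parRight {P Q : Prog A B} {s : S} {ν : PVal (Outcome A B S)} (h : Step I (Q, s) ν) :
      Step I (.par P Q, s) (ν.map (Outcome.continue (fun Q' => .par P Q') P))
  | choice {p : RatProb} {P Q : Prog A B} {s : S} {μ ν : PVal (Outcome A B S)}
      (hP : Step I (P, s) μ) (hQ : Step I (Q, s) ν) :
      Step I (.choice p P Q, s) (PVal.mix p μ ν)
  | nondetLeft {P Q : Prog A B} {s : S} {μ : PVal (Outcome A B S)} (h : Step I (P, s) μ) :
      Step I (.nondet P Q, s) μ
  | nondetRight {P Q : Prog A B} {s : S} {μ : PVal (Outcome A B S)} (h : Step I (Q, s) μ) :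
      Step I (.nondet P Q, s) μ
  | iteTrue {b : B} {P Q : Prog A B} {s : S} (h : I.cond b s = true) :
      Step I (.ite b P Q, s) (PVal.dirac (.inr (P, s)))
  | iteFalse {b : B} {P Q : Prog A B} {s : S} (h : I.cond b s = false) :
      Step I (.ite b P Q, s) (PVal.dirac (.inr (Q, s)))
  | whileTrue {b : B} {P : Prog A B} {s : S} (h : I.cond b s = true) :
      Step I (.whileDo b P, s) (PVal.dirac (.inr (.seq P (.whileDo b P), s)))
  | whileFalse {b : B} {P : Prog A B} {s : S} (h : I.cond b s = false) :
      Step I (.whileDo b P, s) (PVal.dirac (.inl s))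

/-- A history: the configurations visited so far, each with the one-step valuation taken there. -/
abbrev History (A B S : Type*) := List (Config A B S × PVal (Outcome A B S))

/-- A probabilistic scheduler: a partial function from histories and current configurations to
finite distributions over the one-step valuations of the current configuration. -/
structure Scheduler (I : Interp A B S) where
  choose : History A B S → Config A B S → Option (PVal (PVal (Outcome A B S)))
  choose_step : ∀ h c σ, choose h c = some σ → ∀ ν ∈ σ.1.support, Step I c ν

/-- `∑ᵢ pᵢ · m(cᵢ) + ∑ⱼ pⱼ · sⱼ` for `ν = ∑ᵢ pᵢ · cᵢ + ∑ⱼ pⱼ · sⱼ`. -/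
def PVal.collect (ν : PVal (Outcome A B S)) (m : Config A B S → (S →₀ ℝ≥0)) : S →₀ ℝ≥0 :=
  ν.1.sum fun o r => r • Sum.elim (fun t => Finsupp.single t 1) m o

/-- The big-step semantics `h c ⇓^{𝒮,n} μ`. -/
inductive BigStep {I : Interp A B S} (𝒮 : Scheduler I) :
    ℕ → History A B S → Config A B S → (S →₀ ℝ≥0) → Prop
  | zero (h : History A B S) (c : Config A B S) : BigStep 𝒮 0 h c 0
  | succ {n : ℕ} {h : History A B S} {c : Config A B S} {σ : PVal (PVal (Outcome A B S))}
      (m : PVal (Outcome A B S) → Config A B S → (S →₀ ℝ≥0))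
      (hσ : 𝒮.choose h c = some σ)
      (hm : ∀ ν ∈ σ.1.support, ∀ c', Sum.inr c' ∈ ν.1.support →
        BigStep 𝒮 n (h ++ [(c, ν)]) c' (m ν c')) :
      BigStep 𝒮 (n + 1) h c (σ.1.sum fun ν r => r • ν.collect (m ν))

/-- `𝒮` is non-blocking with respect to `h c`. -/
def Scheduler.NonBlocking {I : Interp A B S} (𝒮 : Scheduler I) (h : History A B S)
    (c : Config A B S) : Prop :=
  ∀ n, ∃ μ, BigStep 𝒮 n h c μ

/-! ### The logic -/

/-- The valuations satisfying `(> p) U`: those that terminate in `U` with probability strictly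
greater than `p`. -/
def stat (p : ℝ≥0) (U : Set S) : Set (S →₀ ℝ≥0) := {μ | p < mass μ U}

/-- `c ⊨ ◇ φ`. -/
def SatMay (I : Interp A B S) (c : Config A B S) (φ : Set (S →₀ ℝ≥0)) : Prop :=
  ∃ 𝒮 : Scheduler I, ∃ n, ∃ μ ∈ φ, BigStep 𝒮 n [] c μ

/-- `c ⊨ □ φ`. -/
def SatMust (I : Interp A B S) (c : Config A B S) (φ : Set (S →₀ ℝ≥0)) : Prop :=
  ∀ 𝒮 : Scheduler I, 𝒮.NonBlocking [] c → ∃ n, ∃ μ ∈ φ, BigStep 𝒮 n [] c μ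

/-- The sets `Fₙ` of a configuration: `F₀ = {⊥}`, and `Fₙ₊₁` is the union, over the one-step
valuations `∑ᵢ pᵢ · cᵢ + ∑ⱼ pⱼ · sⱼ` of the configuration, of the Minkowski combinations
`∑ᵢ pᵢ · Fₙ(cᵢ) + ∑ⱼ pⱼ · sⱼ`. -/
def approx (I : Interp A B S) : ℕ → Config A B S → Set (S →₀ ℝ≥0)
  | 0, _ => {0}
  | n + 1, c => {μ | ∃ ν, Step I c ν ∧ ∃ m : Config A B S → (S →₀ ℝ≥0),
      (∀ c', Sum.inr c' ∈ ν.1.support → m c' ∈ approx I n c') ∧ μ = ν.collect m}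

end Semantics

/-! ### Computability -/

/-- The valuation denoted by a finite list of states with rational weights. -/
def ofList {S : Type*} (l : List (S × ℚ≥0)) : S →₀ ℝ≥0 :=
  (l.map fun x => Finsupp.single x.1 (x.2 : ℝ≥0)).sum

/-- A map into valuations is computable with rational weights if some algorithm lists the point
masses of its values with rational coefficients. -/
def ComputableVal {X S : Type*} [Primcodable X] [Primcodable S] (f : X → PVal S) : Prop :=
  ∃ g : X → List (S × ℚ≥0), Computable g ∧ ∀ x, (f x).1 = ofList (g x)

/-- A family of sets of valuations is computably finite if some algorithm lists the elements of
each of its members, with rational coefficients. -/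
def ComputableFin {X S : Type*} [Primcodable X] [Primcodable S]
    (F : X → Set (S →₀ ℝ≥0)) : Prop :=
  ∃ g : X → List (List (S × ℚ≥0)), Computable g ∧ ∀ x, F x = {μ | ∃ l ∈ g x, μ = ofList l}

end

end PGCL

/-! The exhaustive search is correct because a threshold formula speaks only about masses, and `μ ↦
μ(U)` is linear. A randomised choice of a scheduler produces a convex combination of results, and a
real linear functional at a convex combination is at most its largest value at the points combined.
By induction on the depth, a depth-`n` result of any scheduler is therefore dominated, for any one
linear functional, by an element of `Fₙ` (`BigStep.exists_approx_ge`). Applied to the mass of a set,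
this settles may-satisfaction of a disjunction, since a single disjunct is already true; applied to
minus the mass, once for each conjunct, it shows that a conjunction valid on all of `Fₙ` holds for
every depth-`n` result.

Conversely, each element of `Fₙ` is the depth-`n` run of a deterministic history-dependent policy
(`exists_policy_of_mem_approx`): the history tells which branch of the tree has been entered, so
choices made separately for the branches can be glued. Suppose now that every `Fₙ` contains a
counterexample to a conjunction, realised by a policy `fₙ`. Every configuration has finitely many
steps, so the policies have a limit `g` along a nonprincipal ultrafilter (`exists_limit_policy`),
and each finite run of `g` agrees with that of some `fₙ` with `n` arbitrarily large. If `g` met the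
conjunction at depth `k`, so would such an `fₙ` with `n ≥ k`, and then also at depth `n` because
masses only grow with the depth: a contradiction.

For computability, valuations become lists of rationally weighted points. Both the steps of a
configuration and the sets `Fₙ` are recursions along finitely branching trees, which are computable
by tabulating the nodes level by level (`Computable.treeRec`); the Minkowski sums are enumerated by
choosing one result per successor (`approx_eq_approxLists`). A fixed program mentions finitely many
atomic programs and conditions, so separate algorithms for these combine into one. Satisfaction is
then an unbounded search for a suitable `n`. -/

namespace PGCL

noncomputable section

/-! ### Mass as a linear functional -/

section Mass

variable {X : Type*}

theorem mass_zero (U : Set X) : mass (0 : X →₀ ℝ≥0) U = 0 := Finsupp.sum_zero_index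

theorem mass_add (μ ν : X →₀ ℝ≥0) (U : Set X) : mass (μ + ν) U = mass μ U + mass ν U := by
  classical
  refine Finsupp.sum_add_index' (fun x => ?_) (fun x r t => ?_) <;>
    by_cases hx : x ∈ U <;> simp [hx]

theorem mass_smul (r : ℝ≥0) (μ : X →₀ ℝ≥0) (U : Set X) : mass (r • μ) U = r * mass μ U := by
  classical
  unfold mass
  rw [Finsupp.sum_smul_index fun x => by by_cases hx : x ∈ U <;> simp [hx], Finsupp.mul_sum]
  refine Finsupp.sum_congr fun x _ => ?_
  by_cases hx : x ∈ U <;> simp [hx]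

/-- The mass of a set, as a real-valued linear functional. -/
def massLinear (U : Set X) : (X →₀ ℝ≥0) →ₗ[ℝ≥0] ℝ where
  toFun μ := (mass μ U : ℝ)
  map_add' μ ν := by rw [mass_add, NNReal.coe_add]
  map_smul' r μ := by rw [mass_smul, NNReal.coe_mul]; rfl

theorem PVal.support_nonempty (μ : PVal X) : μ.1.support.Nonempty := by
  rw [Finset.nonempty_iff_ne_empty, Ne, Finsupp.support_eq_empty]
  intro h
  have := μ.2
  simp [h, total] at this

/-- The weights sum to one, so an average never exceeds the maximum over the finite nonempty
support. This is what removes randomisation from schedulers. -/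
theorem PVal.exists_sum_le (μ : PVal X) (x : X → ℝ) :
    ∃ a ∈ μ.1.support, (μ.1.sum fun b r => r • x b) ≤ x a := by
  obtain ⟨a, ha, hmax⟩ := μ.1.support.exists_max_image x μ.support_nonempty
  refine ⟨a, ha, ?_⟩
  have h1 : ∑ b ∈ μ.1.support, ((μ.1 b : ℝ≥0) : ℝ) = 1 := by exact_mod_cast μ.2
  calc (μ.1.sum fun b r => r • x b) ≤ ∑ b ∈ μ.1.support, ((μ.1 b : ℝ≥0) : ℝ) * x a :=
        Finset.sum_le_sum fun b hb => mul_le_mul_of_nonneg_left (hmax b hb) (NNReal.coe_nonneg _)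
    _ = x a := by rw [← Finset.sum_mul, h1, one_mul]

end Mass

section Search

variable {A B S : Type*} {I : Interp A B S}

/-! ### The transition system is total and finitely branching -/

/-- Totality provides the default choices of total policies and makes all the sets `Fₙ` nonempty. -/
theorem exists_step (I : Interp A B S) (c : Config A B S) : ∃ ν, Step I c ν := by
  obtain ⟨P, s⟩ := c
  induction P with
  | skip => exact ⟨_, .skip s⟩
  | atom a => exact ⟨_, .atom a s⟩
  | seq P Q hP => exact ⟨_, .seq hP.choose_spec⟩
  | par P Q hP => exact ⟨_, .parLeft hP.choose_spec⟩
  | choice p P Q hP hQ => exact ⟨_, .choice hP.choose_spec hQ.choose_spec⟩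
  | nondet P Q hP => exact ⟨_, .nondetLeft hP.choose_spec⟩
  | ite b P Q =>
    cases h : I.cond b s
    · exact ⟨_, .iteFalse h⟩
    · exact ⟨_, .iteTrue h⟩
  | whileDo b P =>
    cases h : I.cond b s
    · exact ⟨_, .whileFalse h⟩
    · exact ⟨_, .whileTrue h⟩

/-- Nondeterminism arises only from `par` and `nondet`, each of which contributes two finite
families; atomic randomness lies inside one valuation. This finiteness is the compactness behind the
limit policy. -/
theorem finite_setOf_step (I : Interp A B S) (c : Config A B S) : {ν | Step I c ν}.Finite := by
  obtain ⟨P, s⟩ := c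
  induction P with
  | skip => exact (Set.finite_singleton _).subset (by rintro _ ⟨⟩; rfl)
  | atom a => exact (Set.finite_singleton _).subset (by rintro _ ⟨⟩; rfl)
  | seq P Q hP =>
    refine (hP.image (PVal.map (Outcome.continue (fun P' => .seq P' Q) Q))).subset ?_
    rintro _ ⟨⟩
    exact ⟨_, ‹_›, rfl⟩
  | par P Q hP hQ =>
    refine ((hP.image (PVal.map (Outcome.continue (fun P' => .par P' Q) Q))).union
      (hQ.image (PVal.map (Outcome.continue (fun Q' => .par P Q') P)))).subset ?_
    rintro _ ⟨⟩
    · exact Or.inl ⟨_, ‹_›, rfl⟩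
    · exact Or.inr ⟨_, ‹_›, rfl⟩
  | choice p P Q hP hQ =>
    refine (Set.Finite.image2 (PVal.mix p) hP hQ).subset ?_
    rintro _ ⟨⟩
    exact ⟨_, ‹_›, _, ‹_›, rfl⟩
  | nondet P Q hP hQ =>
    refine (hP.union hQ).subset ?_
    rintro _ ⟨⟩
    · exact Or.inl ‹_›
    · exact Or.inr ‹_›
  | ite b P Q =>
    refine (Set.toFinite {PVal.dirac (.inr (P, s)), PVal.dirac (.inr (Q, s))}).subset ?_
    rintro _ ⟨⟩ <;> simp
  | whileDo b P =>
    refine (Set.toFinite {PVal.dirac (.inr (.seq P (.whileDo b P), s)),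
      PVal.dirac (.inl s)}).subset ?_
    rintro _ ⟨⟩ <;> simp

/-! ### Collecting results -/

theorem PVal.collect_congr (ν : PVal (Outcome A B S)) {m m' : Config A B S → (S →₀ ℝ≥0)}
    (h : ∀ c, Sum.inr c ∈ ν.1.support → m c = m' c) : ν.collect m = ν.collect m' := by
  refine Finsupp.sum_congr fun o ho => ?_
  rcases o with s | c
  · rfl
  · simp only [Sum.elim_inr, h c ho]

/-- `L` distributes over the sum and the weights are nonnegative. No positivity of `L` is needed, so
minus a mass is allowed. -/
theorem PVal.collect_mono (ν : PVal (Outcome A B S)) (L : (S →₀ ℝ≥0) →ₗ[ℝ≥0] ℝ)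
    {m m' : Config A B S → (S →₀ ℝ≥0)}
    (h : ∀ c, Sum.inr c ∈ ν.1.support → L (m c) ≤ L (m' c)) :
    L (ν.collect m) ≤ L (ν.collect m') := by
  unfold PVal.collect
  rw [map_finsuppSum, map_finsuppSum]
  refine Finset.sum_le_sum fun o ho => ?_
  simp only [map_smul]
  refine mul_le_mul_of_nonneg_left ?_ (NNReal.coe_nonneg _)
  rcases o with s | c
  · exact le_rfl
  · exact h c ho

/-- The value of a linear functional at a big-step result under any scheduler is dominated by its
value at an element of the exhaustive search. -/
theorem BigStep.exists_approx_ge {𝒮 : Scheduler I} {n : ℕ} {h : History A B S}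
    {c : Config A B S} {μ : S →₀ ℝ≥0} (hb : BigStep 𝒮 n h c μ) (L : (S →₀ ℝ≥0) →ₗ[ℝ≥0] ℝ) :
    ∃ μ' ∈ approx I n c, L μ ≤ L μ' := by
  induction hb with
  | zero h c => exact ⟨0, rfl, le_rfl⟩
  | @succ n h c σ m hσ _ ih =>
    choose! m' hm' hle using ih
    -- The scheduler's lottery over steps is replaced by the one step in its support that is best
    -- for `L`.
    obtain ⟨ν, hν, hmax⟩ := σ.exists_sum_le fun ν => L (ν.collect (m ν))
    refine ⟨ν.collect (m' ν), ⟨ν, 𝒮.choose_step h c σ hσ ν hν, m' ν, hm' ν hν, rfl⟩, ?_⟩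
    rw [map_finsuppSum]
    simp only [map_smul]
    exact hmax.trans (ν.collect_mono L (hle ν hν))

/-! ### Deterministic schedulers -/

/-- A total deterministic choice of steps, depending on the history. -/
abbrev Policy (I : Interp A B S) := History A B S → (c : Config A B S) → {ν // Step I c ν}

/-- The result of `n` steps under a policy. -/
def Policy.run (f : Policy I) : ℕ → History A B S → Config A B S → (S →₀ ℝ≥0)
  | 0, _, _ => 0
  | n + 1, h, c => (f h c).1.collect (f.run n (h ++ [(c, (f h c).1)]))

/-- A policy as a scheduler. -/
def Policy.toScheduler (f : Policy I) : Scheduler I where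
  choose h c := some (PVal.dirac (f h c).1)
  choose_step h c σ hσ ν hν := by
    cases hσ
    obtain rfl : ν = (f h c).1 := by
      by_contra hne
      exact Finsupp.mem_support_iff.1 hν (Finsupp.single_eq_of_ne hne)
    exact (f h c).2

theorem PVal.support_dirac {X : Type*} (x : X) : (PVal.dirac x).1.support = {x} :=
  Finsupp.support_single x one_ne_zero

theorem PVal.dirac_sum {X Y : Type*} (x : X) (g : X → Y →₀ ℝ≥0) :
    ((PVal.dirac x).1.sum fun y r => r • g y) = g x := by
  simp [PVal.dirac]

theorem Policy.bigStep_run (f : Policy I) (n : ℕ) (h : History A B S) (c : Config A B S) :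
    BigStep f.toScheduler n h c (f.run n h c) := by
  induction n generalizing h c with
  | zero => exact .zero h c
  | succ n ih =>
    have := BigStep.succ (𝒮 := f.toScheduler) (n := n) (h := h) (c := c)
      (fun ν c' => f.run n (h ++ [(c, ν)]) c') rfl fun ν _ c' _ => ih _ _
    rwa [PVal.dirac_sum] at this

/-- A policy puts all weight on a single step, so the only freedom left in a derivation is the value
of `m` off the supports, which `collect` ignores. -/
theorem Policy.eq_run_of_bigStep (f : Policy I) {n : ℕ} {h : History A B S} {c : Config A B S}
    {μ : S →₀ ℝ≥0} (hb : BigStep f.toScheduler n h c μ) : μ = f.run n h c := by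
  induction hb with
  | zero => rfl
  | @succ n h c σ m hσ _ ih =>
    cases hσ
    rw [PVal.dirac_sum, Policy.run]
    exact PVal.collect_congr _ fun c' hc' => ih _ (by simp [PVal.support_dirac]) c' hc'

theorem Policy.nonBlocking (f : Policy I) (h : History A B S) (c : Config A B S) :
    f.toScheduler.NonBlocking h c := fun n => ⟨_, f.bigStep_run n h c⟩

/-- Configurations still running at the cut-off contribute zero, so a deeper cut-off can only add
mass. -/
theorem Policy.mass_run_mono (f : Policy I) (U : Set S) (h : History A B S) (c : Config A B S) :
    Monotone fun n => mass (f.run n h c) U := by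
  refine monotone_nat_of_le_succ fun n => ?_
  change massLinear U (f.run n h c) ≤ massLinear U (f.run (n + 1) h c)
  induction n generalizing h c with
  | zero =>
    rw [Policy.run, map_zero]
    exact NNReal.coe_nonneg _
  | succ n ih => exact PVal.collect_mono _ _ fun c' _ => ih _ _

/-- The first configuration of a run with history `h` that is now at `c`. -/
def History.start (h : History A B S) (c : Config A B S) : Config A B S :=
  (h.head?.map Prod.fst).getD c

/-- Histories grow at the end. The starting configuration is thus an invariant of a run and can
serve to remember the branch taken. -/
theorem History.start_append (h : History A B S) (c d : Config A B S)
    (ν : PVal (Outcome A B S)) : History.start (h ++ [(c, ν)]) d = History.start h c := by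
  cases h <;> rfl

/-- A run begun at `c₀` after the prefix `x` consults only histories whose part beyond `x` starts at
`c₀`, so agreement of the policies on those is enough. -/
theorem Policy.run_congr_start {f g : Policy I} {x : History A B S} {c₀ : Config A B S}
    (hfg : ∀ h c, History.start h c = c₀ → f (x ++ h) c = g h c) (n : ℕ) (h : History A B S)
    (c : Config A B S) (hc : History.start h c = c₀) : f.run n (x ++ h) c = g.run n h c := by
  induction n generalizing h c with
  | zero => rfl
  | succ n ih =>
    rw [Policy.run, Policy.run, hfg h c hc]
    refine PVal.collect_congr _ fun c' _ => ?_
    rw [List.append_assoc]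
    exact ih _ _ ((History.start_append ..).trans hc)

/-- The induction gives one policy per successor configuration. They are glued into one by letting
the history determine the successor at which the run continued. -/
theorem exists_policy_of_mem_approx {n : ℕ} {c : Config A B S} {μ : S →₀ ℝ≥0}
    (hμ : μ ∈ approx I n c) : ∃ f : Policy I, f.run n [] c = μ := by
  classical
  have d : Policy I := fun _ c => ⟨_, (exists_step I c).choose_spec⟩
  induction n generalizing c μ with
  | zero => exact ⟨d, hμ.symm⟩
  | succ n ih =>
    obtain ⟨ν, hν, m, hm, rfl⟩ := hμ
    have : ∀ c', ∃ f : Policy I, Sum.inr c' ∈ ν.1.support → f.run n [] c' = m c' := fun c' => by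
      by_cases hc' : Sum.inr c' ∈ ν.1.support
      · obtain ⟨f, hf⟩ := ih (hm c' hc')
        exact ⟨f, fun _ => hf⟩
      · exact ⟨d, fun h => absurd h hc'⟩
    choose g hg using this
    -- After the first entry is dropped, the start of the remaining history is the successor entered
    -- at the first step; if that remainder is empty, it is the current configuration itself.
    let f : Policy I := fun h e => match h with
      | [] => if he : e = c then ⟨ν, he ▸ hν⟩ else d [] e
      | _ :: h => g (History.start h e) h e
    have hf : f [] c = ⟨ν, hν⟩ := dif_pos rfl
    refine ⟨f, ?_⟩
    rw [Policy.run, hf]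
    refine PVal.collect_congr _ fun c' hc' => ?_
    rw [← hg c' hc']
    -- The prefix is written in the form in which `run` extends the empty history.
    refine Policy.run_congr_start (x := [] ++ [(c, ν)]) (c₀ := c') (fun h e he => ?_) n [] c' rfl
    change g (History.start h e) h e = _
    rw [he]

theorem Policy.run_mem_approx (f : Policy I) (n : ℕ) (h : History A B S) (c : Config A B S) :
    f.run n h c ∈ approx I n c := by
  induction n generalizing h c with
  | zero => rfl
  | succ n ih => exact ⟨_, (f h c).2, _, fun c' _ => ih _ c', rfl⟩

theorem approx_nonempty (I : Interp A B S) (n : ℕ) (c : Config A B S) :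
    (approx I n c).Nonempty :=
  ⟨_, Policy.run_mem_approx (fun _ c => ⟨_, (exists_step I c).choose_spec⟩) n [] c⟩

/-- König's lemma for policies: every sequence of policies has a limit whose finite runs agree
with the runs of frequently many members. -/
theorem exists_limit_policy (f : ℕ → Policy I) : ∃ g : Policy I, ∀ k h c,
    ∀ᶠ n in (Filter.hyperfilter ℕ : Filter ℕ), (f n).run k h c = g.run k h c := by
  have : ∀ h c, ∃ x : {ν // Step I c ν},
      ∀ᶠ n in (Filter.hyperfilter ℕ : Filter ℕ), f n h c = x := fun h c => by
    have : Finite {ν // Step I c ν} := finite_setOf_step I c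
    -- An ultrafilter on a finite set is principal: one step is chosen by almost all members of the
    -- sequence, and the limit takes that one.
    obtain ⟨x, hx⟩ := Ultrafilter.eq_pure_of_finite
      ((Filter.hyperfilter ℕ).map fun n => f n h c)
    refine ⟨x, ?_⟩
    have : {x} ∈ (Filter.hyperfilter ℕ).map fun n => f n h c := by rw [hx]; rfl
    exact this
  choose g hg using this
  refine ⟨g, fun k => ?_⟩
  induction k with
  | zero => exact fun _ _ => Filter.Eventually.of_forall fun _ => rfl
  | succ k ih =>
    intro h c
    -- The support is finite, so the agreements at the individual successors hold simultaneously for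
    -- almost all `n`.
    have hall : ∀ᶠ n in (Filter.hyperfilter ℕ : Filter ℕ), ∀ o ∈ (g h c).1.1.support,
        ∀ c', o = Sum.inr c' → (f n).run k (h ++ [(c, (g h c).1)]) c' =
          Policy.run g k (h ++ [(c, (g h c).1)]) c' := by
      rw [Filter.eventually_all_finset]
      rintro (s | c') _
      · exact Filter.Eventually.of_forall fun _ _ h => nomatch h
      · filter_upwards [ih (h ++ [(c, (g h c).1)]) c'] with n hn
        rintro _ ⟨⟩
        exact hn
    filter_upwards [hg h c, hall] with n hn hn'
    rw [Policy.run, Policy.run, hn]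
    exact PVal.collect_congr _ fun c' hc' => hn' _ hc' c' rfl

/-! ### Correctness and completeness of the exhaustive search -/

variable {ι : Type*}

/-- Only the one disjunct satisfied by `μ` has to survive the passage to the dominating element.
Several masses could not in general be preserved at once. -/
theorem satMay_iff (I : Interp A B S) (c : Config A B S) (p : ι → ℝ≥0) (U : ι → Set S) :
    SatMay I c (⋃ i, stat (p i) (U i)) ↔
      ∃ n, ∃ μ ∈ approx I n c, μ ∈ ⋃ i, stat (p i) (U i) := by
  constructor
  · rintro ⟨𝒮, n, μ, hμ, hb⟩
    obtain ⟨i, hi⟩ := Set.mem_iUnion.1 hμ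
    obtain ⟨μ', hμ', hle⟩ := hb.exists_approx_ge (massLinear (U i))
    exact ⟨n, μ', hμ', Set.mem_iUnion.2 ⟨i, lt_of_lt_of_le hi hle⟩⟩
  · rintro ⟨n, μ, hμ, hφ⟩
    obtain ⟨f, rfl⟩ := exists_policy_of_mem_approx hμ
    exact ⟨f.toScheduler, n, _, hφ, f.bigStep_run n [] c⟩

/-- From left to right this is compactness together with monotonicity in the depth. From right to
left, domination is used from below, with a separate witness in `Fₙ` for each conjunct. -/
theorem satMust_iff (I : Interp A B S) (c : Config A B S) (p : ι → ℝ≥0) (U : ι → Set S) :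
    SatMust I c (⋂ i, stat (p i) (U i)) ↔
      ∃ n, ∀ μ ∈ approx I n c, μ ∈ ⋂ i, stat (p i) (U i) := by
  constructor
  · intro h
    by_contra! hcon
    have : ∀ n, ∃ f : Policy I, f.run n [] c ∉ ⋂ i, stat (p i) (U i) := fun n => by
      obtain ⟨μ, hμ, hφ⟩ := hcon n
      obtain ⟨f, rfl⟩ := exists_policy_of_mem_approx hμ
      exact ⟨f, hφ⟩
    choose f hf using this
    obtain ⟨g, hg⟩ := exists_limit_policy f
    obtain ⟨k, μ, hμ, hb⟩ := h g.toScheduler (g.nonBlocking [] c)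
    rw [g.eq_run_of_bigStep hb] at hμ
    -- The ultrafilter is nonprincipal, so a member agreeing with `g` up to depth `k` can be found
    -- with `n ≥ k`.
    obtain ⟨n, hn, hkn⟩ := ((hg k [] c).and
      (Nat.hyperfilter_le_atTop (Filter.eventually_ge_atTop k))).exists
    refine hf n (Set.mem_iInter.2 fun i => ?_)
    have hi : p i < mass (g.run k [] c) (U i) := Set.mem_iInter.1 hμ i
    rw [← hn] at hi
    exact hi.trans_le ((f n).mass_run_mono (U i) [] c hkn)
  · rintro ⟨n, hn⟩ 𝒮 h𝒮
    obtain ⟨μ, hb⟩ := h𝒮 n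
    refine ⟨n, μ, Set.mem_iInter.2 fun i => ?_, hb⟩
    -- With the sign reversed, domination reads `mass μ' (U i) ≤ mass μ (U i)`.
    obtain ⟨μ', hμ', hle⟩ := hb.exists_approx_ge (-massLinear (U i))
    have h1 : p i < mass μ' (U i) := Set.mem_iInter.1 (hn μ' hμ') i
    exact h1.trans_le (NNReal.coe_le_coe.1 (neg_le_neg_iff.1 hle))

end Search

end

end PGCL

/-! ### Computable operations on lists -/

/-- Read off the value at `b` in the table `V` of values at the keys `L`. -/
def List.valueAt {β σ : Type*} [DecidableEq β] (d : σ) (L : List β) (V : List σ) (b : β) : σ :=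
  V[L.idxOf b]?.getD d

/-- Repeated keys do no harm: the first occurrence is looked up, and all occurrences carry the same
value. The default `d` is never reached for a key in the list. -/
theorem List.valueAt_map {β σ : Type*} [DecidableEq β] (d : σ) (L : List β) (f : β → σ) {b : β}
    (hb : b ∈ L) : L.valueAt d (L.map f) b = f b := by
  have h := List.idxOf_lt_length_of_mem hb
  simp [List.valueAt, List.getElem?_eq_getElem h]

/-! ### Recursion along a finitely branching tree -/

section TreeRec

variable {β σ : Type*}

/-- Recursion to depth `n` along the tree in which `c` has the children `succs c`. -/
def treeRec (base : β → σ) (succs : β → List β) (comb : β → List σ → σ) : ℕ → β → σ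
  | 0, c => base c
  | n + 1, c => comb c ((succs c).map (treeRec base succs comb n))

/-- The nodes at depth `n` below `c`. -/
def treeLevel (succs : β → List β) (c : β) (n : ℕ) : List β :=
  Nat.rec (motive := fun _ => List β) [c] (fun _ l => l.flatMap succs) n

/-- The values of the recursion at the nodes of depth `n - k` below `c`, computed bottom-up. -/
def treeTable [DecidableEq β] (base : β → σ) (succs : β → List β) (comb : β → List σ → σ)
    (x : ℕ × β) (k : ℕ) : List σ :=
  Nat.rec (motive := fun _ => List σ) ((treeLevel succs x.2 x.1).map base)
    (fun k V => (treeLevel succs x.2 (x.1 - (k + 1))).map fun d => comb d ((succs d).map fun e =>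
      (treeLevel succs x.2 (x.1 - k)).valueAt (base e) V e)) k

/-- `treeRec` calls itself at many nodes, so it is not directly a recursion carrying one state. The
table of values on a whole finite level is such a state, and the level above is computed from it.
The bound `k ≤ n` keeps the truncated subtraction honest. -/
theorem treeTable_eq [DecidableEq β] (base : β → σ) (succs : β → List β) (comb : β → List σ → σ)
    (n : ℕ) (c : β) (k : ℕ) (hk : k ≤ n) : treeTable base succs comb (n, c) k =
      (treeLevel succs c (n - k)).map (treeRec base succs comb k) := by
  induction k with
  | zero => rfl
  | succ k ih =>
    refine List.map_congr_left fun d hd => ?_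
    rw [treeRec]
    congr 1
    refine List.map_congr_left fun e he => ?_
    change (treeLevel succs c (n - k)).valueAt (base e) (treeTable base succs comb (n, c) k) e = _
    rw [ih (by omega), List.valueAt_map]
    -- The children of the nodes at depth `n - (k + 1)` form the level `n - k`, hence are keys of
    -- the previous table.
    rw [show n - k = (n - (k + 1)) + 1 by omega]
    exact List.mem_flatMap.2 ⟨d, hd, he⟩

end TreeRec

/-! ### Computability of list operations -/

namespace Computable

variable {α β σ : Type*} [Primcodable α] [Primcodable β] [Primcodable σ]

/-- The fold becomes a recursion on the length of the list, reading the entry at each position. -/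
theorem list_foldl {f : α → List β} {g : α → σ} {h : α → σ × β → σ} (hf : Computable f)
    (hg : Computable g) (hh : Computable₂ h) :
    Computable fun a => (f a).foldl (fun s b => h a (s, b)) (g a) := by
  have key := Computable.nat_rec (f := fun a => (f a).length) (g := g)
    (h := fun a (x : ℕ × σ) =>
      Option.casesOn (motive := fun _ => σ) (f a)[x.1]? x.2 fun b => h a (x.2, b))
    (list_length.comp hf) hg
    (Computable.option_casesOn (list_getElem?.comp (hf.comp fst) (fst.comp snd)) (snd.comp snd)
      (hh.comp (fst.comp fst) ((snd.comp (snd.comp fst)).pair snd)).to₂).to₂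
  refine key.of_eq fun a => ?_
  -- After `n` rounds the state is the fold of the first `n` entries; past the end of the list the
  -- missing entry leaves it unchanged.
  have : ∀ n, Nat.rec (motive := fun _ => σ) (g a) (fun y IH =>
      Option.casesOn (motive := fun _ => σ) (f a)[y]? IH fun b => h a (IH, b)) n =
      ((f a).take n).foldl (fun s b => h a (s, b)) (g a) := fun n => by
    induction n with
    | zero => simp
    | succ n ih =>
      rw [List.take_add_one, List.foldl_append, ← ih]
      change Option.casesOn (motive := fun _ => σ) (f a)[n]? _ _ = _
      rcases (f a)[n]? with _ | b <;> rfl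
  rw [this, List.take_length]

theorem list_foldr {f : α → List β} {g : α → σ} {h : α → β × σ → σ} (hf : Computable f)
    (hg : Computable g) (hh : Computable₂ h) :
    Computable fun a => (f a).foldr (fun b s => h a (b, s)) (g a) :=
  (list_foldl (h := fun a x => h a (x.2, x.1)) (list_reverse.comp hf) hg
    (hh.comp fst ((snd.comp snd).pair (fst.comp snd))).to₂).of_eq fun a => by
      simp [List.foldl_reverse]

theorem list_map {f : α → List β} {g : α → β → σ} (hf : Computable f) (hg : Computable₂ g) :
    Computable fun a => (f a).map (g a) :=
  (list_foldr (h := fun a x => g a x.1 :: x.2) hf (const [])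
    (list_cons.comp (hg.comp fst (fst.comp snd)) (snd.comp snd)).to₂).of_eq fun a => by
      induction f a <;> simp_all

theorem list_flatMap {f : α → List β} {g : α → β → List σ} (hf : Computable f)
    (hg : Computable₂ g) : Computable fun a => (f a).flatMap (g a) :=
  (list_foldr (h := fun a x => g a x.1 ++ x.2) hf (const [])
    (list_append.comp (hg.comp fst (fst.comp snd)) (snd.comp snd)).to₂).of_eq fun a => by
      induction f a <;> simp_all

theorem list_all {f : α → List β} {g : α → β → Bool} (hf : Computable f) (hg : Computable₂ g) :
    Computable fun a => (f a).all (g a) :=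
  (list_foldr (h := fun a x => bif g a x.1 then x.2 else false) hf (const true)
    (cond (hg.comp fst (fst.comp snd)) (snd.comp snd) (const false)).to₂).of_eq fun a => by
      induction f a with
      | nil => rfl
      | cons b l ih => simp only [List.foldr_cons, List.all_cons, ih]; cases g a b <;> rfl

theorem bool_not {f : α → Bool} (hf : Computable f) : Computable fun a => !f a :=
  (cond hf (const false) (const true)).of_eq fun a => by cases f a <;> rfl

theorem list_any {f : α → List β} {g : α → β → Bool} (hf : Computable f) (hg : Computable₂ g) :
    Computable fun a => (f a).any (g a) :=
  (bool_not (list_all (g := fun a b => !g a b) hf (bool_not hg).to₂)).of_eq fun a => by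
    rw [List.any_eq_not_all_not]

theorem list_sections {f : α → List (List β)} (hf : Computable f) :
    Computable fun a => (f a).sections := by
  refine (list_foldr (h := fun _ (x : List β × List (List β)) =>
    x.2.flatMap fun s => x.1.map fun b => b :: s) hf (const [[]]) ?_).of_eq fun a => ?_
  · have h1 : Computable₂ fun (y : (α × List β × List (List β)) × List β) (b : β) => b :: y.2 :=
      list_cons.comp snd (snd.comp fst)
    have h2 : Computable₂ fun (y : α × List β × List (List β)) (s : List β) =>
        y.2.1.map fun b => b :: s := list_map (fst.comp (snd.comp fst)) h1
    exact list_flatMap (snd.comp snd) h2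
  · induction f a with
    | nil => rfl
    | cons l L ih => rw [List.foldr_cons, ih]; rfl

theorem list_sum_map {f : α → List β} {g : α → β → σ} [AddMonoid σ] (hf : Computable f)
    (hg : Computable₂ g) (hadd : Computable₂ fun x y : σ => x + y) :
    Computable fun a => ((f a).map (g a)).sum :=
  (list_foldr (h := fun a x => g a x.1 + x.2) hf (const 0)
    (hadd.comp (hg.comp fst (fst.comp snd)) (snd.comp snd)).to₂).of_eq fun a => by
      induction f a <;> simp_all

theorem list_valueAt [DecidableEq β] {d : α → σ} {L : α → List β} {V : α → List σ} {b : α → β}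
    (hd : Computable d) (hL : Computable L) (hV : Computable V) (hb : Computable b) :
    Computable fun a => (L a).valueAt (d a) (V a) (b a) :=
  option_getD (list_getElem?.comp hV (Primrec.list_idxOf.to_comp.comp hb hL)) hd

/-! ### Recursion along a computable finitely branching tree -/

theorem treeLevel {succs : β → List β} (hsuccs : Computable succs) :
    Computable₂ (treeLevel succs) :=
  Computable.nat_rec (h := fun _ (x : ℕ × List β) => x.2.flatMap succs) snd
    (list_cons.comp fst (const [])) (list_flatMap (snd.comp snd) (hsuccs.comp snd).to₂).to₂

theorem treeTable [DecidableEq β] {base : β → σ} {succs : β → List β} {comb : β → List σ → σ}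
    (hbase : Computable base) (hsuccs : Computable succs) (hcomb : Computable₂ comb) :
    Computable₂ (treeTable base succs comb) := by
  have hsub : Computable₂ fun m n : ℕ => m - n := Primrec.nat_sub.to_comp
  have hlevel := Computable.treeLevel hsuccs
  have hvalue : Computable₂ fun (y : ((ℕ × β) × ℕ × List σ) × β) (e : β) =>
      (_root_.treeLevel succs y.1.1.2 (y.1.1.1 - y.1.2.1)).valueAt (base e) y.1.2.2 e := by
    have h1 : Computable fun y : (((ℕ × β) × ℕ × List σ) × β) × β => y.1.1 := fst.comp fst
    exact list_valueAt (hbase.comp snd) (hlevel.comp (snd.comp (fst.comp h1))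
      (hsub.comp (fst.comp (fst.comp h1)) (fst.comp (snd.comp h1)))) (snd.comp (snd.comp h1)) snd
  have hcombine : Computable₂ fun (y : (ℕ × β) × ℕ × List σ) (d : β) =>
      comb d ((succs d).map fun e =>
        (_root_.treeLevel succs y.1.2 (y.1.1 - y.2.1)).valueAt (base e) y.2.2 e) :=
    hcomb.comp snd (list_map (hsuccs.comp snd) hvalue)
  have hstep : Computable₂ fun (y : ℕ × β) (x : ℕ × List σ) =>
      (_root_.treeLevel succs y.2 (y.1 - (x.1 + 1))).map fun d => comb d ((succs d).map fun e =>
        (_root_.treeLevel succs y.2 (y.1 - x.1)).valueAt (base e) x.2 e) :=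
    list_map (hlevel.comp (snd.comp fst) (hsub.comp (fst.comp fst) (succ.comp (fst.comp snd))))
      hcombine
  have hbase' : Computable fun x : ℕ × β => (_root_.treeLevel succs x.2 x.1).map base :=
    list_map (hlevel.comp snd fst) (hbase.comp snd).to₂
  have hstep' : Computable₂ fun (y : (ℕ × β) × ℕ) (x : ℕ × List σ) =>
      (_root_.treeLevel succs y.1.2 (y.1.1 - (x.1 + 1))).map fun d => comb d ((succs d).map fun e =>
        (_root_.treeLevel succs y.1.2 (y.1.1 - x.1)).valueAt (base e) x.2 e) :=
    hstep.comp (fst.comp fst) snd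
  have key := Computable.nat_rec (Computable.snd (α := ℕ × β) (β := ℕ)) (hbase'.comp fst) hstep'
  exact key.of_eq fun _ => rfl

theorem treeRec {base : β → σ} {succs : β → List β} {comb : β → List σ → σ}
    (hbase : Computable base) (hsuccs : Computable succs) (hcomb : Computable₂ comb) :
    Computable₂ (treeRec base succs comb) := by
  let _ : DecidableEq β := Encodable.decidableEqOfEncodable β
  have htable := Computable.treeTable hbase hsuccs hcomb
  -- After `n` rounds the table covers level zero, whose only node is the root, so the answer is
  -- entry `0`.
  refine (option_getD (f := fun x : ℕ × β => (_root_.treeTable base succs comb x x.1)[0]?)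
    (g := fun x => base x.2) (list_getElem?.comp (htable.comp Computable.id fst) (const 0))
    (hbase.comp snd)).of_eq fun x => ?_
  rw [treeTable_eq base succs comb x.1 x.2 x.1 le_rfl, Nat.sub_self]
  rfl

/-- The finitely many values are tabulated and the required one is read off, so no uniform algorithm
for `f` is assumed. -/
theorem finCasesOn {n : ℕ} {f : Fin n → α → σ} (hf : ∀ i, Computable (f i)) :
    Computable fun x : Fin n × α => f x.1 x.2 :=
  option_some_iff.1 <|
    (list_getElem?.comp ((list_ofFn hf).comp snd) (Primrec.fin_val.to_comp.comp fst)).of_eq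
      fun x => by simp

end Computable

/-! ### Arithmetic of nonnegative rationals is primitive recursive -/

namespace PGCL

/-- The gcd is found by bounded search. The bound `a + b` remains valid when one argument is zero;
when both are, it leaves only the value `0`. -/
theorem primrec_gcd : Primrec₂ Nat.gcd := by
  refine (Primrec.nat_findGreatest (f := fun x : ℕ × ℕ => x.1 + x.2)
    (p := fun x d => x.1 % d = 0 ∧ x.2 % d = 0) (Primrec.nat_add.comp Primrec.fst Primrec.snd)
    (PrimrecPred.and ?_ ?_)).of_eq ?_
  · exact Primrec.eq.comp (Primrec.nat_mod.comp (Primrec.fst.comp Primrec.fst) Primrec.snd)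
      (Primrec.const 0)
  · exact Primrec.eq.comp (Primrec.nat_mod.comp (Primrec.snd.comp Primrec.fst) Primrec.snd)
      (Primrec.const 0)
  · rintro ⟨a, b⟩
    rw [Nat.findGreatest_eq_iff]
    refine ⟨?_, fun _ => ⟨Nat.mod_eq_zero_of_dvd (Nat.gcd_dvd_left a b),
      Nat.mod_eq_zero_of_dvd (Nat.gcd_dvd_right a b)⟩, ?_⟩
    · rcases Nat.eq_zero_or_pos a with rfl | ha
      · simp
      · exact (Nat.gcd_le_left b ha).trans (Nat.le_add_right a b)
    · rintro d hd hle ⟨h1, h2⟩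
      have hdvd := Nat.dvd_gcd (Nat.dvd_of_mod_eq_zero h1) (Nat.dvd_of_mod_eq_zero h2)
      rcases Nat.eq_zero_or_pos (a.gcd b) with h0 | h0
      · rw [Nat.gcd_eq_zero_iff] at h0
        simp only [h0.1, h0.2, Nat.gcd_self, Nat.add_zero] at hd hle
        omega
      · exact absurd (Nat.le_of_dvd h0 hdvd) (not_le.2 hd)

theorem divNat_parts_of_coprime {n d : ℕ} (hd : 0 < d) (h : n.Coprime d) :
    (NNRat.divNat n d).num = n ∧ (NNRat.divNat n d).den = d := by
  have : NNRat.divNat n d = nnratEquiv.symm ⟨(n, d), hd, h⟩ :=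
    NNRat.num_divNat_den (nnratEquiv.symm ⟨(n, d), hd, h⟩)
  rw [this]
  exact ⟨rfl, rfl⟩

theorem divNat_parts {n d : ℕ} (hd : 0 < d) :
    (NNRat.divNat n d).num = n / n.gcd d ∧ (NNRat.divNat n d).den = d / n.gcd d := by
  have hg : 0 < n.gcd d := Nat.gcd_pos_of_pos_right n hd
  have h := divNat_parts_of_coprime (Nat.div_pos (Nat.gcd_le_right n hd) hg)
    (Nat.coprime_div_gcd_div_gcd hg)
  rwa [← NNRat.divNat_mul_left hg.ne', Nat.mul_div_cancel' (Nat.gcd_dvd_left n d),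
    Nat.mul_div_cancel' (Nat.gcd_dvd_right n d)] at h

/-- Rationals are encoded by reduced fractions, so forming a quotient amounts to cancelling the gcd.
The zero denominator is treated apart: there the quotient is `0`, with parts `(0, 1)`. -/
theorem primrec_divNat : Primrec₂ NNRat.divNat := by
  have h1 : Primrec fun x : ℕ × ℕ => (x.1 / x.1.gcd x.2, x.2 / x.1.gcd x.2) :=
    (Primrec.nat_div.comp Primrec.fst (primrec_gcd.comp Primrec.fst Primrec.snd)).pair
      (Primrec.nat_div.comp Primrec.snd (primrec_gcd.comp Primrec.fst Primrec.snd))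
  have h2 : Primrec fun x : ℕ × ℕ =>
      if x.2 = 0 then (0, 1) else (x.1 / x.1.gcd x.2, x.2 / x.1.gcd x.2) :=
    Primrec.ite (Primrec.eq.comp Primrec.snd (Primrec.const 0)) (Primrec.const (0, 1)) h1
  refine Primrec.encode_iff.1 ((Primrec.encode.comp h2).of_eq ?_)
  rintro ⟨n, d⟩
  change _ = Encodable.encode ((NNRat.divNat n d).num, (NNRat.divNat n d).den)
  congr 1
  rcases Nat.eq_zero_or_pos d with rfl | hd
  · rw [NNRat.divNat_zero]
    rfl
  · rw [if_neg hd.ne', (divNat_parts hd).1, (divNat_parts hd).2]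

theorem primrec_nnrat_num : Primrec NNRat.num := Primrec.fst.comp primrec_nnrat_parts

theorem primrec_nnrat_den : Primrec NNRat.den := Primrec.snd.comp primrec_nnrat_parts

theorem primrec_nnrat_add : Primrec₂ fun p q : ℚ≥0 => p + q := by
  refine (primrec_divNat.comp (Primrec.nat_add.comp
    (Primrec.nat_mul.comp (primrec_nnrat_num.comp Primrec.fst) (primrec_nnrat_den.comp Primrec.snd))
    (Primrec.nat_mul.comp (primrec_nnrat_num.comp Primrec.snd)
      (primrec_nnrat_den.comp Primrec.fst)))
    (Primrec.nat_mul.comp (primrec_nnrat_den.comp Primrec.fst)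
      (primrec_nnrat_den.comp Primrec.snd))).of_eq fun x => ?_
  exact (NNRat.add_def _ _).symm

theorem primrec_nnrat_mul : Primrec₂ fun p q : ℚ≥0 => p * q := by
  refine (primrec_divNat.comp
    (Primrec.nat_mul.comp (primrec_nnrat_num.comp Primrec.fst) (primrec_nnrat_num.comp Primrec.snd))
    (Primrec.nat_mul.comp (primrec_nnrat_den.comp Primrec.fst)
      (primrec_nnrat_den.comp Primrec.snd))).of_eq fun x => ?_
  exact (NNRat.mul_def _ _).symm

theorem primrec_nnrat_lt : PrimrecRel fun p q : ℚ≥0 => p < q := by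
  refine (Primrec.nat_lt.comp
    (Primrec.nat_mul.comp (primrec_nnrat_num.comp Primrec.fst) (primrec_nnrat_den.comp Primrec.snd))
    (Primrec.nat_mul.comp (primrec_nnrat_num.comp Primrec.snd)
      (primrec_nnrat_den.comp Primrec.fst))).of_eq fun x => ?_
  exact NNRat.lt_def.symm

/-- The complementary probability. -/
def RatProb.compl (p : RatProb) : ℚ≥0 := NNRat.divNat (p.1.den - p.1.num) p.1.den

theorem RatProb.add_compl (p : RatProb) : p.1 + p.compl = 1 := by
  -- This makes the truncated subtraction in `compl` exact.
  have hle : p.1.num ≤ p.1.den := by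
    have := NNRat.le_def.1 p.2
    simpa using this
  have hd : (p.1.den : ℚ≥0) ≠ 0 := by exact_mod_cast p.1.den_ne_zero
  conv_lhs => rw [← NNRat.num_divNat_den p.1]
  rw [RatProb.compl, NNRat.divNat_eq_div, NNRat.divNat_eq_div, ← add_div, ← Nat.cast_add,
    Nat.add_sub_cancel' hle, div_self hd]

theorem primrec_ratProb_val : Primrec fun p : RatProb => p.1 :=
  Primrec.subtype_val

theorem primrec_ratProb_compl : Primrec RatProb.compl :=
  primrec_divNat.comp
    (Primrec.nat_sub.comp (primrec_nnrat_den.comp primrec_ratProb_val)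
      (primrec_nnrat_num.comp primrec_ratProb_val))
    (primrec_nnrat_den.comp primrec_ratProb_val)

end PGCL

namespace PGCL

/-! ### Case analysis on programs is computable -/

namespace Prog

variable {A B X Y : Type*}

/-- Case analysis on programs. -/
def elim (skip' : Y) (atom' : A → Y) (seq' par' nondet' : Prog A B × Prog A B → Y)
    (choice' : RatProb × Prog A B × Prog A B → Y) (ite' : B × Prog A B × Prog A B → Y)
    (while' : B × Prog A B → Y) : Prog A B → Y
  | skip => skip'
  | atom a => atom' a
  | seq P Q => seq' (P, Q)
  | par P Q => par' (P, Q)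
  | nondet P Q => nondet' (P, Q)
  | choice p P Q => choice' (p, P, Q)
  | ite b P Q => ite' (b, P, Q)
  | whileDo b P => while' (b, P)

open Encodable

variable [Primcodable A] [Primcodable B]

theorem decode_code (P : Prog A B) : decode P.code = some P := encodek P

/-- After the tag, a Gödel number carries exactly the encoding of the tuple of arguments, so one
call of `decode` recovers them. The `- 1` undoes the final successor of `code`. -/
theorem decStep_code (skip' : Y) (atom' : A → Y) (seq' par' nondet' : Prog A B × Prog A B → Y)
    (choice' : RatProb × Prog A B × Prog A B → Y) (ite' : B × Prog A B × Prog A B → Y)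
    (while' : B × Prog A B → Y) (P : Prog A B) :
    (let n := P.code - 1
     let m := n.unpair.2
     if n.unpair.1 = 0 then some skip'
     else if n.unpair.1 = 1 then (decode (α := A) m).map atom'
     else if n.unpair.1 = 2 then (decode (α := Prog A B × Prog A B) m).map seq'
     else if n.unpair.1 = 3 then (decode (α := Prog A B × Prog A B) m).map par'
     else if n.unpair.1 = 4 then (decode (α := Prog A B × Prog A B) m).map nondet'
     else if n.unpair.1 = 5 then (decode (α := RatProb × Prog A B × Prog A B) m).map choice'
     else if n.unpair.1 = 6 then (decode (α := B × Prog A B × Prog A B) m).map ite'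
     else (decode (α := B × Prog A B) m).map while') =
    some (P.elim skip' atom' seq' par' nondet' choice' ite' while') := by
  cases P <;> simp [code, elim, decode_code]

variable [Primcodable X] [Primcodable Y]

theorem computable_elim {f : X → Prog A B} {skip' : X → Y} {atom' : X → A → Y}
    {seq' par' nondet' : X → Prog A B × Prog A B → Y}
    {choice' : X → RatProb × Prog A B × Prog A B → Y}
    {ite' : X → B × Prog A B × Prog A B → Y} {while' : X → B × Prog A B → Y}
    (hf : Computable f) (hskip : Computable skip') (hatom : Computable₂ atom')
    (hseq : Computable₂ seq') (hpar : Computable₂ par') (hnondet : Computable₂ nondet')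
    (hchoice : Computable₂ choice') (hite : Computable₂ ite') (hwhile : Computable₂ while') :
    Computable fun x => (f x).elim (skip' x) (atom' x) (seq' x) (par' x) (nondet' x) (choice' x)
      (ite' x) (while' x) := by
  have hn : Computable fun x => ((f x).code - 1).unpair :=
    Computable.unpair.comp (Computable.pred.comp (Computable.encode.comp hf))
  have hm : Computable fun x => ((f x).code - 1).unpair.2 := Computable.snd.comp hn
  have hbranch : ∀ (k : ℕ) {u v : X → Option Y}, Computable u → Computable v →
      Computable fun x => if ((f x).code - 1).unpair.1 = k then u x else v x := by
    intro k u v hu hv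
    refine (Computable.cond (c := fun x => decide (((f x).code - 1).unpair.1 = k))
      (Primrec.eq.decide.to_comp.comp (Computable.fst.comp hn) (Computable.const k))
      hu hv).of_eq fun x => ?_
    rw [Bool.cond_decide]
  refine Computable.option_some_iff.1 (Computable.of_eq ?_ fun x => decStep_code _ _ _ _ _ _ _ _ _)
  exact hbranch 0 (Computable.option_some.comp hskip)
    (hbranch 1 (Computable.option_map (Computable.decode.comp hm) hatom)
    (hbranch 2 (Computable.option_map (Computable.decode.comp hm) hseq)
    (hbranch 3 (Computable.option_map (Computable.decode.comp hm) hpar)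
    (hbranch 4 (Computable.option_map (Computable.decode.comp hm) hnondet)
    (hbranch 5 (Computable.option_map (Computable.decode.comp hm) hchoice)
    (hbranch 6 (Computable.option_map (Computable.decode.comp hm) hite)
    (Computable.option_map (Computable.decode.comp hm) hwhile)))))))

theorem primrec_seq : Primrec₂ (seq : Prog A B → Prog A B → Prog A B) :=
  Primrec.encode_iff.1 (Primrec.succ.comp (Primrec₂.natPair.comp (Primrec.const 2)
    (Primrec₂.natPair.comp (Primrec.encode.comp Primrec.fst) (Primrec.encode.comp Primrec.snd))))

theorem primrec_par : Primrec₂ (par : Prog A B → Prog A B → Prog A B) :=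
  Primrec.encode_iff.1 (Primrec.succ.comp (Primrec₂.natPair.comp (Primrec.const 3)
    (Primrec₂.natPair.comp (Primrec.encode.comp Primrec.fst) (Primrec.encode.comp Primrec.snd))))

theorem primrec_whileDo : Primrec₂ (whileDo : B → Prog A B → Prog A B) :=
  Primrec.encode_iff.1 (Primrec.succ.comp (Primrec₂.natPair.comp (Primrec.const 7)
    (Primrec₂.natPair.comp (Primrec.encode.comp Primrec.fst) (Primrec.encode.comp Primrec.snd))))

end Prog

/-! ### Lists of weighted points -/

section Lists

variable {X Y : Type*}

/-- Multiply all weights of a list by `q`. -/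
def scaleList (q : ℚ≥0) (l : List (X × ℚ≥0)) : List (X × ℚ≥0) := l.map fun x => (x.1, q * x.2)

/-- Apply a function to all points of a list. -/
def mapList (f : X → Y) (l : List (X × ℚ≥0)) : List (Y × ℚ≥0) := l.map fun x => (f x.1, x.2)

theorem ofList_nil : ofList ([] : List (X × ℚ≥0)) = 0 := rfl

theorem ofList_cons (x : X × ℚ≥0) (l : List (X × ℚ≥0)) :
    ofList (x :: l) = Finsupp.single x.1 (x.2 : ℝ≥0) + ofList l := rfl

theorem ofList_append (l l' : List (X × ℚ≥0)) : ofList (l ++ l') = ofList l + ofList l' := by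
  simp [ofList]

theorem ofList_scaleList (q : ℚ≥0) (l : List (X × ℚ≥0)) :
    ofList (scaleList q l) = (q : ℝ≥0) • ofList l := by
  induction l with
  | nil => simp [scaleList, ofList]
  | cons x l ih =>
    rw [scaleList, List.map_cons, ofList_cons, ofList_cons, ← scaleList, ih, smul_add,
      Finsupp.smul_single, NNRat.cast_mul, smul_eq_mul]

theorem ofList_mapList (f : X → Y) (l : List (X × ℚ≥0)) :
    ofList (mapList f l) = Finsupp.mapDomain f (ofList l) := by
  induction l with
  | nil => simp [mapList, ofList]
  | cons x l ih =>
    rw [mapList, List.map_cons, ofList_cons, ofList_cons, ← mapList, ih, Finsupp.mapDomain_add,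
      Finsupp.mapDomain_single]

/-- The converse fails, since listed weights may be zero. A list may therefore mention more points
than the support. -/
theorem exists_mem_of_mem_support_ofList {l : List (X × ℚ≥0)} {o : X}
    (h : o ∈ (ofList l).support) : ∃ q, (o, q) ∈ l := by
  classical
  induction l with
  | nil => simp [ofList] at h
  | cons x l ih =>
    rw [ofList_cons] at h
    rcases Finset.mem_union.1 (Finsupp.support_add h) with h | h
    · obtain rfl := Finset.mem_singleton.1 (Finsupp.support_single_subset h)
      exact ⟨x.2, List.mem_cons_self⟩
    · obtain ⟨q, hq⟩ := ih h
      exact ⟨q, List.mem_cons_of_mem _ hq⟩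

variable [Primcodable X] [Primcodable Y]

theorem computable_scaleList : Computable₂ (scaleList : ℚ≥0 → List (X × ℚ≥0) → _) := by
  have h : Computable₂ fun (y : ℚ≥0 × List (X × ℚ≥0)) (x : X × ℚ≥0) => (x.1, y.1 * x.2) :=
    (Computable.fst.comp Computable.snd).pair
      (primrec_nnrat_mul.to_comp.comp (Computable.fst.comp Computable.fst)
        (Computable.snd.comp Computable.snd))
  exact Computable.list_map Computable.snd h

theorem computable_mapList {Z : Type*} [Primcodable Z] {f : Z → X → Y}
    {l : Z → List (X × ℚ≥0)} (hf : Computable₂ f) (hl : Computable l) :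
    Computable fun z => mapList (f z) (l z) := by
  have h : Computable₂ fun (z : Z) (x : X × ℚ≥0) => (f z x.1, x.2) :=
    (hf.comp Computable.fst (Computable.fst.comp Computable.snd)).pair
      (Computable.snd.comp Computable.snd)
  exact Computable.list_map hl h

end Lists

noncomputable section

section Steps

variable {A B S : Type*}

/-! ### Listing the steps of a configuration -/

/-- The configurations on whose steps those of a configuration depend. -/
def stepArgs : Config A B S → List (Config A B S)
  | (.skip, _) => []
  | (.atom _, _) => []
  | (.seq P _, s) => [(P, s)]
  | (.par P Q, s) => [(P, s), (Q, s)]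
  | (.choice _ P Q, s) => [(P, s), (Q, s)]
  | (.nondet P Q, s) => [(P, s), (Q, s)]
  | (.ite _ _ _, _) => []
  | (.whileDo _ _, _) => []

/-- The steps of a configuration as weighted lists, from those of `stepArgs`. -/
def stepComb (g : A × S → List (S × ℚ≥0)) (e : B × S → Bool) :
    Config A B S → List (List (List (Outcome A B S × ℚ≥0))) →
      List (List (Outcome A B S × ℚ≥0))
  | (.skip, s), _ => [[(.inl s, 1)]]
  | (.atom a, s), _ => [mapList .inl (g (a, s))]
  | (.seq _ Q, _), V => (V[0]?.getD []).map (mapList (Outcome.continue (fun P' => .seq P' Q) Q))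
  | (.par P Q, _), V => (V[0]?.getD []).map (mapList (Outcome.continue (fun P' => .par P' Q) Q)) ++
      (V[1]?.getD []).map (mapList (Outcome.continue (fun Q' => .par P Q') P))
  | (.choice p _ _, _), V => (V[0]?.getD []).flatMap fun l => (V[1]?.getD []).map fun l' =>
      scaleList p.1 l ++ scaleList p.compl l'
  | (.nondet _ _, _), V => V[0]?.getD [] ++ V[1]?.getD []
  | (.ite b P Q, s), _ => [[(.inr (bif e (b, s) then P else Q, s), 1)]]
  | (.whileDo b P, s), _ =>
      [[(bif e (b, s) then .inr (.seq P (.whileDo b P), s) else .inl s, 1)]]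

/-- The steps found by recursion to depth `n` along the structure of the program. -/
def stepLists (g : A × S → List (S × ℚ≥0)) (e : B × S → Bool) :
    ℕ → Config A B S → List (List (Outcome A B S × ℚ≥0)) :=
  treeRec (fun _ => []) stepArgs (stepComb g e)

theorem PVal.mix_val {X : Type*} (p : RatProb) (μ ν : PVal X) :
    (PVal.mix p μ ν).1 = ((p.1 : ℚ≥0) : ℝ≥0) • μ.1 + ((p.compl : ℚ≥0) : ℝ≥0) • ν.1 := by
  have h : ((p.compl : ℚ≥0) : ℝ≥0) = 1 - ((p.1 : ℚ≥0) : ℝ≥0) := by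
    refine (tsub_eq_of_eq_add ?_).symm
    rw [add_comm, ← NNRat.cast_add, p.add_compl, NNRat.cast_one]
  rw [h]
  rfl

theorem ofList_single {X : Type*} (x : X) : ofList [(x, (1 : ℚ≥0))] = (PVal.dirac x).1 := by
  simp [ofList, PVal.dirac]

/-- The weighted lists `V` represent the steps of `c`. -/
def ListsSteps (I : Interp A B S) (c : Config A B S)
    (V : List (List (Outcome A B S × ℚ≥0))) : Prop :=
  (∀ ν, Step I c ν → ∃ l ∈ V, ν.1 = ofList l) ∧ ∀ l ∈ V, ∃ ν, Step I c ν ∧ ν.1 = ofList l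

variable [Primcodable A] [Primcodable B]

/-- The Gödel number serves as fuel: it exceeds those of the immediate subprograms, so a recursion
of depth greater than `P.code` never meets the empty default of an exhausted recursion. -/
theorem listsSteps_stepLists {I : Interp A B S} {g : A × S → List (S × ℚ≥0)}
    {e : B × S → Bool} (hg : ∀ a s, (I.atom a s).1 = ofList (g (a, s)))
    (he : ∀ b s, I.cond b s = e (b, s)) (P : Prog A B) (s : S) (n : ℕ) (hn : P.code < n) :
    ListsSteps I (P, s) (stepLists g e n (P, s)) := by
  have hmap : ∀ {f : Outcome A B S → Outcome A B S} {ν : PVal (Outcome A B S)}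
      {l : List (Outcome A B S × ℚ≥0)}, ν.1 = ofList l → (ν.map f).1 = ofList (mapList f l) :=
    fun h => by rw [ofList_mapList, ← h]; rfl
  induction P generalizing n with
  | skip =>
    obtain ⟨n, rfl⟩ := Nat.exists_eq_succ_of_ne_zero (Nat.ne_zero_of_lt hn)
    refine ⟨?_, ?_⟩
    · rintro _ ⟨⟩
      exact ⟨_, List.mem_singleton_self _, (ofList_single _).symm⟩
    · intro l hl
      rw [List.mem_singleton.1 hl, ofList_single]
      exact ⟨_, .skip s, rfl⟩
  | atom a =>
    obtain ⟨n, rfl⟩ := Nat.exists_eq_succ_of_ne_zero (Nat.ne_zero_of_lt hn)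
    have h : ((I.atom a s).map Sum.inl : PVal (Outcome A B S)).1 =
        ofList (mapList Sum.inl (g (a, s))) := by rw [ofList_mapList, ← hg]; rfl
    refine ⟨?_, ?_⟩
    · rintro _ ⟨⟩
      exact ⟨_, List.mem_singleton_self _, h⟩
    · intro l hl
      rw [List.mem_singleton.1 hl]
      exact ⟨_, .atom a s, h⟩
  | seq P Q hP hQ =>
    obtain ⟨n, rfl⟩ := Nat.exists_eq_succ_of_ne_zero (Nat.ne_zero_of_lt hn)
    -- Pairing dominates its components, and the successor in `code` pays for the level of recursion
    -- just used.
    have hPn : P.code < n := lt_of_le_of_lt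
      ((Nat.left_le_pair _ _).trans (Nat.right_le_pair 2 _)) (Nat.lt_of_succ_lt_succ hn)
    obtain ⟨hP1, hP2⟩ := hP n hPn
    refine ⟨?_, ?_⟩
    · rintro _ ⟨⟩
      rename_i ν h
      obtain ⟨l, hl, hν⟩ := hP1 ν h
      exact ⟨_, List.mem_map_of_mem hl, hmap hν⟩
    · intro l hl
      obtain ⟨l₀, hl₀, rfl⟩ := List.mem_map.1 hl
      obtain ⟨ν, h, hν⟩ := hP2 l₀ hl₀
      exact ⟨_, .seq h, hmap hν⟩
  | par P Q hP hQ =>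
    obtain ⟨n, rfl⟩ := Nat.exists_eq_succ_of_ne_zero (Nat.ne_zero_of_lt hn)
    have hPn : P.code < n := lt_of_le_of_lt
      ((Nat.left_le_pair _ _).trans (Nat.right_le_pair 3 _)) (Nat.lt_of_succ_lt_succ hn)
    have hQn : Q.code < n := lt_of_le_of_lt
      ((Nat.right_le_pair _ _).trans (Nat.right_le_pair 3 _)) (Nat.lt_of_succ_lt_succ hn)
    obtain ⟨hP1, hP2⟩ := hP n hPn
    obtain ⟨hQ1, hQ2⟩ := hQ n hQn
    refine ⟨?_, ?_⟩
    · rintro _ ⟨⟩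
      · rename_i ν h
        obtain ⟨l, hl, hν⟩ := hP1 ν h
        exact ⟨_, List.mem_append_left _ (List.mem_map_of_mem hl), hmap hν⟩
      · rename_i ν h
        obtain ⟨l, hl, hν⟩ := hQ1 ν h
        exact ⟨_, List.mem_append_right _ (List.mem_map_of_mem hl), hmap hν⟩
    · intro l hl
      rcases List.mem_append.1 hl with hl | hl
      · obtain ⟨l₀, hl₀, rfl⟩ := List.mem_map.1 hl
        obtain ⟨ν, h, hν⟩ := hP2 l₀ hl₀
        exact ⟨_, .parLeft h, hmap hν⟩
      · obtain ⟨l₀, hl₀, rfl⟩ := List.mem_map.1 hl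
        obtain ⟨ν, h, hν⟩ := hQ2 l₀ hl₀
        exact ⟨_, .parRight h, hmap hν⟩
  | choice p P Q hP hQ =>
    obtain ⟨n, rfl⟩ := Nat.exists_eq_succ_of_ne_zero (Nat.ne_zero_of_lt hn)
    have hPn : P.code < n := lt_of_le_of_lt ((Nat.left_le_pair _ _).trans
      ((Nat.right_le_pair _ _).trans (Nat.right_le_pair 5 _))) (Nat.lt_of_succ_lt_succ hn)
    have hQn : Q.code < n := lt_of_le_of_lt ((Nat.right_le_pair _ _).trans
      ((Nat.right_le_pair _ _).trans (Nat.right_le_pair 5 _))) (Nat.lt_of_succ_lt_succ hn)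
    obtain ⟨hP1, hP2⟩ := hP n hPn
    obtain ⟨hQ1, hQ2⟩ := hQ n hQn
    have hmix : ∀ {μ ν : PVal (Outcome A B S)} {l l' : List (Outcome A B S × ℚ≥0)},
        μ.1 = ofList l → ν.1 = ofList l' →
        (PVal.mix p μ ν).1 = ofList (scaleList p.1 l ++ scaleList p.compl l') := fun h h' => by
      rw [PVal.mix_val, ofList_append, ofList_scaleList, ofList_scaleList, h, h']
    refine ⟨?_, ?_⟩
    · rintro _ ⟨⟩
      rename_i μ ν hμ hν
      obtain ⟨l, hl, h⟩ := hP1 μ hμ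
      obtain ⟨l', hl', h'⟩ := hQ1 ν hν
      exact ⟨_, List.mem_flatMap.2 ⟨l, hl, List.mem_map_of_mem hl'⟩, hmix h h'⟩
    · intro l hl
      obtain ⟨l₁, hl₁, hl⟩ := List.mem_flatMap.1 hl
      obtain ⟨l₂, hl₂, rfl⟩ := List.mem_map.1 hl
      obtain ⟨μ, hμ, h⟩ := hP2 l₁ hl₁
      obtain ⟨ν, hν, h'⟩ := hQ2 l₂ hl₂
      exact ⟨_, .choice hμ hν, hmix h h'⟩
  | nondet P Q hP hQ =>
    obtain ⟨n, rfl⟩ := Nat.exists_eq_succ_of_ne_zero (Nat.ne_zero_of_lt hn)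
    have hPn : P.code < n := lt_of_le_of_lt
      ((Nat.left_le_pair _ _).trans (Nat.right_le_pair 4 _)) (Nat.lt_of_succ_lt_succ hn)
    have hQn : Q.code < n := lt_of_le_of_lt
      ((Nat.right_le_pair _ _).trans (Nat.right_le_pair 4 _)) (Nat.lt_of_succ_lt_succ hn)
    obtain ⟨hP1, hP2⟩ := hP n hPn
    obtain ⟨hQ1, hQ2⟩ := hQ n hQn
    refine ⟨?_, ?_⟩
    · rintro ν ⟨⟩
      · obtain ⟨l, hl, hν⟩ := hP1 ν ‹_›
        exact ⟨_, List.mem_append_left _ hl, hν⟩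
      · obtain ⟨l, hl, hν⟩ := hQ1 ν ‹_›
        exact ⟨_, List.mem_append_right _ hl, hν⟩
    · intro l hl
      rcases List.mem_append.1 hl with hl | hl
      · obtain ⟨ν, h, hν⟩ := hP2 l hl
        exact ⟨_, .nondetLeft h, hν⟩
      · obtain ⟨ν, h, hν⟩ := hQ2 l hl
        exact ⟨_, .nondetRight h, hν⟩
  | ite b P Q =>
    obtain ⟨n, rfl⟩ := Nat.exists_eq_succ_of_ne_zero (Nat.ne_zero_of_lt hn)
    change ListsSteps I _ [[(Sum.inr (bif e (b, s) then P else Q, s), 1)]]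
    cases h : e (b, s) <;> rw [← he] at h
    · refine ⟨?_, fun l hl => ?_⟩
      · rintro _ ⟨⟩
        · simp_all
        · exact ⟨_, List.mem_singleton_self _, (ofList_single _).symm⟩
      · rw [List.mem_singleton.1 hl, ofList_single]
        exact ⟨_, .iteFalse h, rfl⟩
    · refine ⟨?_, fun l hl => ?_⟩
      · rintro _ ⟨⟩
        · exact ⟨_, List.mem_singleton_self _, (ofList_single _).symm⟩
        · simp_all
      · rw [List.mem_singleton.1 hl, ofList_single]
        exact ⟨_, .iteTrue h, rfl⟩
  | whileDo b P =>
    obtain ⟨n, rfl⟩ := Nat.exists_eq_succ_of_ne_zero (Nat.ne_zero_of_lt hn)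
    change ListsSteps I _
      [[(bif e (b, s) then .inr (.seq P (.whileDo b P), s) else .inl s, 1)]]
    cases h : e (b, s) <;> rw [← he] at h
    · refine ⟨?_, fun l hl => ?_⟩
      · rintro _ ⟨⟩
        · simp_all
        · exact ⟨_, List.mem_singleton_self _, (ofList_single _).symm⟩
      · rw [List.mem_singleton.1 hl, ofList_single]
        exact ⟨_, .whileFalse h, rfl⟩
    · refine ⟨?_, fun l hl => ?_⟩
      · rintro _ ⟨⟩
        · exact ⟨_, List.mem_singleton_self _, (ofList_single _).symm⟩
        · simp_all
      · rw [List.mem_singleton.1 hl, ofList_single]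
        exact ⟨_, .whileTrue h, rfl⟩

end Steps

end

end PGCL

namespace PGCL

noncomputable section

variable {A B S : Type*}

/-! ### Computability of the one-step semantics -/

section StepComputable

variable [Primcodable A] [Primcodable B] [Primcodable S]

open Computable

theorem computable_outcomeContinue {X : Type*} [Primcodable X] {k : X → Prog A B → Prog A B}
    {Q : X → Prog A B} {o : X → Outcome A B S} (hk : Computable₂ k) (hQ : Computable Q)
    (ho : Computable o) : Computable fun x => Outcome.continue (k x) (Q x) (o x) := by
  have h1 : Computable₂ fun (x : X) (t : S) => (Sum.inr (Q x, t) : Outcome A B S) :=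
    sumInr.comp ((hQ.comp fst).pair snd)
  have h2 : Computable₂ fun (x : X) (c : Config A B S) =>
      (Sum.inr (k x c.1, c.2) : Outcome A B S) :=
    sumInr.comp ((hk.comp fst (fst.comp snd)).pair (snd.comp snd))
  refine (Computable.sumCasesOn ho h1 h2).of_eq fun x => ?_
  rcases o x with t | c <;> rfl

theorem computable_getD_nil {X Y : Type*} [Primcodable X] [Primcodable Y] {V : X → List (List Y)}
    (hV : Computable V) (i : ℕ) : Computable fun x => (V x)[i]?.getD [] :=
  option_getD (list_getElem?.comp hV (Computable.const i)) (Computable.const [])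

theorem computable_stepArgs : Computable (stepArgs : Config A B S → List (Config A B S)) := by
  have hone : Computable₂ fun (c : Config A B S) (P : Prog A B) => [(P, c.2)] :=
    list_cons.comp (snd.pair (snd.comp fst)) (const [])
  have htwo : Computable₂ fun (c : Config A B S) (x : Prog A B × Prog A B) =>
      [(x.1, c.2), (x.2, c.2)] :=
    list_cons.comp ((fst.comp snd).pair (snd.comp fst)) (hone.comp fst (snd.comp snd))
  have hseq : Computable₂ fun (c : Config A B S) (x : Prog A B × Prog A B) => [(x.1, c.2)] :=
    hone.comp fst (fst.comp snd)
  have hchoice : Computable₂ fun (c : Config A B S) (x : RatProb × Prog A B × Prog A B) =>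
      [(x.2.1, c.2), (x.2.2, c.2)] := htwo.comp fst (snd.comp snd)
  refine (Prog.computable_elim (X := Config A B S) (Y := List (Config A B S)) fst (const [])
    (const []).to₂ hseq htwo htwo hchoice (const []).to₂ (const []).to₂).of_eq ?_
  rintro ⟨_ | _ | _ | _ | _ | _ | _ | _, s⟩ <;> rfl

theorem computable_stepComb {g : A × S → List (S × ℚ≥0)} {e : B × S → Bool}
    (hg : Computable g) (he : Computable e) :
    Computable₂ (stepComb g e : Config A B S → _ → _) := by
  let X := Config A B S × List (List (List (Outcome A B S × ℚ≥0)))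
  let Y := List (List (Outcome A B S × ℚ≥0))
  have hstate : Computable fun x : X => x.1.2 := snd.comp fst
  have hV : ∀ i : ℕ, Computable fun x : X => (x.2[i]?.getD [] : Y) :=
    fun i => computable_getD_nil snd i
  have hdirac : Computable fun o : Outcome A B S => ([[(o, 1)]] : Y) :=
    list_cons.comp (list_cons.comp (Computable.id.pair (const 1)) (const [])) (const [])
  have hskip : Computable fun x : X => ([[(.inl x.1.2, 1)]] : Y) :=
    hdirac.comp (sumInl.comp hstate)
  have hatom : Computable₂ fun (x : X) (a : A) => ([mapList .inl (g (a, x.1.2))] : Y) := by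
    have h : Computable fun y : X × A => (mapList .inl (g (y.2, y.1.1.2)) :
        List (Outcome A B S × ℚ≥0)) :=
      computable_mapList (f := fun (_ : X × A) (s : S) => (Sum.inl s : Outcome A B S))
        (sumInl.comp snd) (hg.comp (snd.pair (hstate.comp fst)))
    exact list_cons.comp h (const [])
  have hmap : ∀ (i : ℕ) {k : Prog A B × Prog A B → Prog A B → Prog A B}
      {Q : Prog A B × Prog A B → Prog A B}, Computable₂ k → Computable Q →
      Computable₂ fun (x : X) (y : Prog A B × Prog A B) =>
        ((x.2[i]?.getD []).map (mapList (Outcome.continue (k y) (Q y))) : Y) := by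
    intro i k Q hk hQ
    have h1 : Computable₂ fun (z : (X × Prog A B × Prog A B) × List (Outcome A B S × ℚ≥0))
        (o : Outcome A B S) => Outcome.continue (k z.1.2) (Q z.1.2) o :=
      computable_outcomeContinue
        (k := fun w : ((X × Prog A B × Prog A B) × List (Outcome A B S × ℚ≥0)) × Outcome A B S =>
          k w.1.1.2)
        (hk.comp (snd.comp (fst.comp (fst.comp fst))) snd)
        (hQ.comp (snd.comp (fst.comp fst))) snd
    have h2 : Computable₂ fun (z : X × Prog A B × Prog A B)
        (l : List (Outcome A B S × ℚ≥0)) => mapList (Outcome.continue (k z.2) (Q z.2)) l :=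
      computable_mapList h1 snd
    exact list_map ((hV i).comp fst) h2
  have hseq : Computable₂ fun (x : X) (y : Prog A B × Prog A B) =>
      ((x.2[0]?.getD []).map (mapList (Outcome.continue (fun P' => .seq P' y.2) y.2)) : Y) :=
    hmap 0 (k := fun y P' => .seq P' y.2) (Prog.primrec_seq.to_comp.comp snd (snd.comp fst)) snd
  have hpar : Computable₂ fun (x : X) (y : Prog A B × Prog A B) =>
      ((x.2[0]?.getD []).map (mapList (Outcome.continue (fun P' => .par P' y.2) y.2)) ++
        (x.2[1]?.getD []).map (mapList (Outcome.continue (fun Q' => .par y.1 Q') y.1)) : Y) :=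
    list_append.comp
      (hmap 0 (k := fun y P' => .par P' y.2) (Prog.primrec_par.to_comp.comp snd (snd.comp fst)) snd)
      (hmap 1 (k := fun y Q' => .par y.1 Q') (Prog.primrec_par.to_comp.comp (fst.comp fst) snd) fst)
  have hnondet : Computable₂ fun (x : X) (_ : Prog A B × Prog A B) =>
      (x.2[0]?.getD [] ++ x.2[1]?.getD [] : Y) :=
    (list_append.comp (hV 0) (hV 1)).comp fst
  have hchoice : Computable₂ fun (x : X) (y : RatProb × Prog A B × Prog A B) =>
      ((x.2[0]?.getD []).flatMap fun l => (x.2[1]?.getD []).map fun l' =>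
        scaleList y.1.1 l ++ scaleList y.1.compl l' : Y) := by
    have h1 : Computable₂ fun (z : (X × RatProb × Prog A B × Prog A B) ×
        List (Outcome A B S × ℚ≥0)) (l' : List (Outcome A B S × ℚ≥0)) =>
        scaleList z.1.2.1.1 z.2 ++ scaleList z.1.2.1.compl l' := by
      have hp : Computable fun w : ((X × RatProb × Prog A B × Prog A B) ×
          List (Outcome A B S × ℚ≥0)) × List (Outcome A B S × ℚ≥0) => w.1.1.2.1 :=
        fst.comp (snd.comp (fst.comp fst))
      exact list_append.comp
        (computable_scaleList.comp (primrec_ratProb_val.to_comp.comp hp) (snd.comp fst))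
        (computable_scaleList.comp (primrec_ratProb_compl.to_comp.comp hp) snd)
    have h2 : Computable₂ fun (z : X × RatProb × Prog A B × Prog A B)
        (l : List (Outcome A B S × ℚ≥0)) => (z.1.2[1]?.getD []).map fun l' =>
          scaleList z.2.1.1 l ++ scaleList z.2.1.compl l' :=
      list_map ((hV 1).comp (fst.comp fst)) h1
    exact list_flatMap ((hV 0).comp fst) h2
  have hite : Computable₂ fun (x : X) (y : B × Prog A B × Prog A B) =>
      ([[(.inr (bif e (y.1, x.1.2) then y.2.1 else y.2.2, x.1.2), 1)]] : Y) := by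
    have h1 : Computable fun z : X × B × Prog A B × Prog A B =>
        bif e (z.2.1, z.1.1.2) then z.2.2.1 else z.2.2.2 :=
      Computable.cond (he.comp ((fst.comp snd).pair (hstate.comp fst)))
        (fst.comp (snd.comp snd)) (snd.comp (snd.comp snd))
    exact hdirac.comp (sumInr.comp (h1.pair (hstate.comp fst)))
  have hwhile : Computable₂ fun (x : X) (y : B × Prog A B) =>
      ([[(bif e (y.1, x.1.2) then .inr (.seq y.2 (.whileDo y.1 y.2), x.1.2) else .inl x.1.2,
        1)]] : Y) := by
    have h1 : Computable fun z : X × B × Prog A B => Prog.seq z.2.2 (.whileDo z.2.1 z.2.2) :=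
      Prog.primrec_seq.to_comp.comp (snd.comp snd)
        (Prog.primrec_whileDo.to_comp.comp (fst.comp snd) (snd.comp snd))
    have h2 : Computable fun z : X × B × Prog A B => (bif e (z.2.1, z.1.1.2) then
        .inr (.seq z.2.2 (.whileDo z.2.1 z.2.2), z.1.1.2) else .inl z.1.1.2 : Outcome A B S) :=
      Computable.cond (he.comp ((fst.comp snd).pair (hstate.comp fst)))
        (sumInr.comp (h1.pair (hstate.comp fst))) (sumInl.comp (hstate.comp fst))
    exact hdirac.comp h2
  refine (Prog.computable_elim (X := X) (Y := Y) (fst.comp fst) hskip hatom hseq hpar hnondet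
    hchoice hite hwhile).of_eq ?_
  rintro ⟨⟨_ | _ | _ | _ | _ | _ | _ | _, s⟩, V⟩ <;> rfl

/-- The steps of a configuration, as weighted lists. -/
def steps (g : A × S → List (S × ℚ≥0)) (e : B × S → Bool) (c : Config A B S) :
    List (List (Outcome A B S × ℚ≥0)) :=
  stepLists g e (c.1.code + 1) c

theorem computable_steps {g : A × S → List (S × ℚ≥0)} {e : B × S → Bool}
    (hg : Computable g) (he : Computable e) :
    Computable (steps g e : Config A B S → _) := by
  have h : Computable₂ (stepLists g e : ℕ → Config A B S → _) :=
    Computable.treeRec (const []) computable_stepArgs (computable_stepComb hg he)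
  exact h.comp (succ.comp (Computable.encode.comp fst)) Computable.id

end StepComputable

/-! ### Listing the results of the exhaustive search -/

/-- The configurations occurring in a list of weighted lists. -/
def nextConfigs (L : List (List (Outcome A B S × ℚ≥0))) : List (Config A B S) :=
  L.flatMap fun l => l.flatMap fun x => Sum.elim (fun _ => []) (fun c => [c]) x.1

/-- The list version of `PVal.collect`, for results `α` listed along the keys `K`. -/
def collectList [DecidableEq (Config A B S)] (K : List (Config A B S))
    (α : List (List (S × ℚ≥0))) (l : List (Outcome A B S × ℚ≥0)) : List (S × ℚ≥0) :=
  l.flatMap fun x => Sum.elim (fun s => [(s, x.2)])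
    (fun c => scaleList x.2 (K.valueAt [] α c)) x.1

theorem mem_nextConfigs {L : List (List (Outcome A B S × ℚ≥0))}
    {l : List (Outcome A B S × ℚ≥0)} (hl : l ∈ L) {ν : PVal (Outcome A B S)}
    (hν : ν.1 = ofList l) {c : Config A B S} (hc : Sum.inr c ∈ ν.1.support) :
    c ∈ nextConfigs L := by
  rw [hν] at hc
  obtain ⟨q, hq⟩ := exists_mem_of_mem_support_ofList hc
  exact List.mem_flatMap.2 ⟨l, hl, List.mem_flatMap.2 ⟨_, hq, List.mem_singleton_self c⟩⟩

/-- `collect` is additive in the coefficients, so a point may occur several times in the list, or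
with weight zero, without changing the result. -/
theorem ofList_collectList [DecidableEq (Config A B S)] (K : List (Config A B S))
    (α : List (List (S × ℚ≥0))) {l : List (Outcome A B S × ℚ≥0)} {ν : PVal (Outcome A B S)}
    (hν : ν.1 = ofList l) :
    ofList (collectList K α l) = ν.collect fun c => ofList (K.valueAt [] α c) := by
  rw [PVal.collect, hν]
  -- The induction passes to tails, whose total mass need no longer be one, so the link to `ν` is
  -- dropped.
  clear hν
  induction l with
  | nil => simp [collectList, ofList]
  | cons x l ih =>
    rw [ofList_cons, Finsupp.sum_add_index' (h := fun o r => r • Sum.elim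
      (fun t => Finsupp.single t 1) (fun c => ofList (K.valueAt [] α c)) o)
      (fun o => zero_smul ℝ≥0 _) (fun o r t => add_smul r t _), Finsupp.sum_single_index
      (h := fun o r => r • Sum.elim (fun t => Finsupp.single t 1)
        (fun c => ofList (K.valueAt [] α c)) o) (zero_smul ℝ≥0 _), ← ih, collectList, List.flatMap_cons,
      ofList_append, ← collectList]
    congr 1
    obtain ⟨s | c, q⟩ := x
    · simp [ofList]
    · exact ofList_scaleList _ _

/-- One round of the search, from the results of the next configurations. -/
def approxComb [DecidableEq (Config A B S)]
    (st : Config A B S → List (List (Outcome A B S × ℚ≥0)))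
    (c : Config A B S) (V : List (List (List (S × ℚ≥0)))) : List (List (S × ℚ≥0)) :=
  V.sections.flatMap fun α => (st c).map (collectList (nextConfigs (st c)) α)

/-- The results of the exhaustive search, as weighted lists. -/
def approxLists [DecidableEq (Config A B S)]
    (st : Config A B S → List (List (Outcome A B S × ℚ≥0))) :
    ℕ → Config A B S → List (List (S × ℚ≥0)) :=
  treeRec (fun _ => [[]]) (fun c => nextConfigs (st c)) (approxComb st)

/-- A section picks one result per key position. Even if it picks differently at repeated keys,
reading the first occurrence yields a genuine function of the key. -/
theorem valueAt_mem_of_mem_sections {β σ : Type*} [DecidableEq β] (d : σ) {L : List β}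
    {F : β → List σ} {α : List σ} (hα : α ∈ (L.map F).sections) {b : β} (hb : b ∈ L) :
    L.valueAt d α b ∈ F b := by
  have h := List.mem_sections.1 hα
  have hlt := List.idxOf_lt_length_of_mem hb
  have hlt' : L.idxOf b < α.length := by rwa [h.length_eq, List.length_map]
  have := List.Forall₂.get h hlt' (by rwa [List.length_map])
  rw [List.valueAt, List.getElem?_eq_getElem hlt', Option.getD_some]
  simpa using this

theorem map_mem_sections {β σ : Type*} {L : List β} {F : β → List σ} {w : β → σ}
    (hw : ∀ b ∈ L, w b ∈ F b) : L.map w ∈ (L.map F).sections := by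
  rw [List.mem_sections, List.forall₂_map_left_iff, List.forall₂_map_right_iff]
  exact List.forall₂_same.2 hw

/-- An element of a Minkowski sum is given by a choice of one result per successor, and such choices
are the sections of the lists of results. The keys are the successors of all steps of `c` together,
a superset of what any single step needs. -/
theorem approx_eq_approxLists [DecidableEq (Config A B S)] {I : Interp A B S}
    {st : Config A B S → List (List (Outcome A B S × ℚ≥0))} (hst : ∀ c, ListsSteps I c (st c))
    (n : ℕ) (c : Config A B S) :
    approx I n c = {μ | ∃ l ∈ approxLists st n c, μ = ofList l} := by
  induction n generalizing c with
  | zero =>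
    ext μ
    refine ⟨fun h => ⟨[], List.mem_singleton_self _, h⟩, ?_⟩
    rintro ⟨l, hl, rfl⟩
    rw [List.mem_singleton.1 hl]
    rfl
  | succ n ih =>
    ext μ
    constructor
    · rintro ⟨ν, hν, m, hm, rfl⟩
      obtain ⟨l, hl, hνl⟩ := (hst c).1 ν hν
      -- A section must choose at every key, including those outside the support of `ν`; there an
      -- arbitrary result serves, which exists because `Fₙ` is nonempty.
      have : ∀ c', ∃ w ∈ approxLists st n c', Sum.inr c' ∈ ν.1.support → m c' = ofList w := by
        intro c'
        by_cases hc' : Sum.inr c' ∈ ν.1.support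
        · have h := hm c' hc'
          rw [ih] at h
          obtain ⟨w, hw, h⟩ := h
          exact ⟨w, hw, fun _ => h⟩
        · have h := approx_nonempty I n c'
          rw [ih] at h
          obtain ⟨_, w, hw, _⟩ := h
          exact ⟨w, hw, fun h => absurd h hc'⟩
      choose w hw hwm using this
      refine ⟨collectList (nextConfigs (st c)) ((nextConfigs (st c)).map w) l,
        List.mem_flatMap.2 ⟨_, map_mem_sections fun c' _ => hw c', List.mem_map_of_mem hl⟩, ?_⟩
      rw [ofList_collectList _ _ hνl]
      refine PVal.collect_congr _ fun c' hc' => ?_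
      rw [List.valueAt_map _ _ _ (mem_nextConfigs hl hνl hc'), hwm c' hc']
    · rintro ⟨_, hl, rfl⟩
      obtain ⟨α, hα, hl⟩ := List.mem_flatMap.1 hl
      obtain ⟨l₀, hl₀, rfl⟩ := List.mem_map.1 hl
      obtain ⟨ν, hν, hνl⟩ := (hst c).2 l₀ hl₀
      refine ⟨ν, hν, _, fun c' hc' => ?_, ofList_collectList _ _ hνl⟩
      rw [ih]
      exact ⟨_, valueAt_mem_of_mem_sections [] hα (mem_nextConfigs hl₀ hνl hc'), rfl⟩

/-! ### Computability of the exhaustive search -/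

section ApproxComputable

variable [Primcodable A] [Primcodable B] [Primcodable S]

open Computable

theorem computable_nextConfigs :
    Computable (nextConfigs : List (List (Outcome A B S × ℚ≥0)) → List (Config A B S)) := by
  have h1 : Computable fun x : Outcome A B S × ℚ≥0 =>
      (Sum.elim (fun _ => []) (fun c => [c]) x.1 : List (Config A B S)) := by
    refine (Computable.sumCasesOn (f := fun x : Outcome A B S × ℚ≥0 => x.1)
      (g := fun _ _ => ([] : List (Config A B S))) (h := fun _ c => [c]) fst (const []).to₂
      (list_cons.comp snd (const [])).to₂).of_eq ?_
    rintro ⟨_ | _, _⟩ <;> rfl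
  have h2 : Computable fun l : List (Outcome A B S × ℚ≥0) =>
      (l.flatMap fun x => Sum.elim (fun _ => []) (fun c => [c]) x.1 : List (Config A B S)) :=
    list_flatMap Computable.id (h1.comp snd).to₂
  exact list_flatMap Computable.id (h2.comp snd).to₂

theorem computable_collectList [DecidableEq (Config A B S)] :
    Computable fun x : (List (Config A B S) × List (List (S × ℚ≥0))) ×
      List (Outcome A B S × ℚ≥0) => collectList x.1.1 x.1.2 x.2 := by
  let X := ((List (Config A B S) × List (List (S × ℚ≥0))) × List (Outcome A B S × ℚ≥0)) ×
    (Outcome A B S × ℚ≥0)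
  have h1 : Computable₂ fun (y : X) (s : S) => [(s, y.2.2)] :=
    list_cons.comp (snd.pair (snd.comp (snd.comp fst))) (const [])
  have h2 : Computable₂ fun (y : X) (c : Config A B S) =>
      scaleList y.2.2 (y.1.1.1.valueAt [] y.1.1.2 c) := by
    have h3 : Computable fun z : X × Config A B S => z.1.1.1 := fst.comp (fst.comp fst)
    exact computable_scaleList.comp (snd.comp (snd.comp fst))
      (list_valueAt (const []) (fst.comp h3) (snd.comp h3) snd)
  have h4 : Computable fun y : X => Sum.elim (fun s => [(s, y.2.2)])
      (fun c => scaleList y.2.2 (y.1.1.1.valueAt [] y.1.1.2 c)) y.2.1 := by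
    refine (Computable.sumCasesOn (f := fun y : X => y.2.1) (fst.comp snd) h1 h2).of_eq ?_
    rintro ⟨_, _ | _, _⟩ <;> rfl
  exact list_flatMap snd h4.to₂

theorem computable_approxComb [DecidableEq (Config A B S)]
    {st : Config A B S → List (List (Outcome A B S × ℚ≥0))} (hst : Computable st) :
    Computable₂ (approxComb st) := by
  have h1 : Computable₂ fun (y : (Config A B S × List (List (List (S × ℚ≥0)))) ×
      List (List (S × ℚ≥0))) (l : List (Outcome A B S × ℚ≥0)) =>
      collectList (nextConfigs (st y.1.1)) y.2 l := by
    have h : Computable fun z : ((Config A B S × List (List (List (S × ℚ≥0)))) ×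
      List (List (S × ℚ≥0))) × List (Outcome A B S × ℚ≥0) =>
        ((nextConfigs (st z.1.1.1), z.1.2), z.2) :=
      (((computable_nextConfigs.comp hst).comp (fst.comp (fst.comp fst))).pair
        (snd.comp fst)).pair snd
    have h' := (computable_collectList (A := A) (B := B) (S := S)).comp h
    exact h'
  have h2 : Computable₂ fun (y : Config A B S × List (List (List (S × ℚ≥0))))
      (α : List (List (S × ℚ≥0))) =>
      (st y.1).map (collectList (nextConfigs (st y.1)) α) :=
    list_map (hst.comp (fst.comp fst)) h1
  have h3 : Computable fun y : Config A B S × List (List (List (S × ℚ≥0))) => y.2.sections :=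
    list_sections snd
  have h4 := list_flatMap h3 h2
  exact h4

theorem computable_approxLists [DecidableEq (Config A B S)]
    {st : Config A B S → List (List (Outcome A B S × ℚ≥0))} (hst : Computable st) :
    Computable₂ (approxLists st) := by
  have hbase : Computable fun _ : Config A B S => ([[]] : List (List (S × ℚ≥0))) := const [[]]
  have key := Computable.treeRec hbase (computable_nextConfigs.comp hst)
    (computable_approxComb hst)
  exact key

/-- The exhaustive search is computable if the interpretation is. -/
theorem computableFin_approx {I : Interp A B S}
    (hatom : ComputableVal fun x : A × S => I.atom x.1 x.2)
    (hcond : Computable fun x : B × S => I.cond x.1 x.2) :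
    ComputableFin fun x : ℕ × Config A B S => approx I x.1 x.2 := by
  let _ : DecidableEq (Config A B S) := Encodable.decidableEqOfEncodable _
  obtain ⟨g, hg, hgI⟩ := hatom
  exact ⟨fun x => approxLists (steps g fun x => I.cond x.1 x.2) x.1 x.2,
    computable_approxLists (computable_steps hg hcond),
    fun x => approx_eq_approxLists (fun c => listsSteps_stepLists (fun a s => hgI (a, s))
      (fun _ _ => rfl) c.1 c.2 _ (Nat.lt_succ_self _)) x.1 x.2⟩

end ApproxComputable

end

end PGCL

namespace PGCL

/-! ### Restriction to the atomic programs and conditions of a program -/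

section Restrict

variable {A B S : Type*}

/-- All atomic programs of `P` satisfy `p`, and all its conditions `q`. -/
def Prog.Over (p : A → Prop) (q : B → Prop) : Prog A B → Prop
  | skip => True
  | atom a => p a
  | seq P Q => P.Over p q ∧ Q.Over p q
  | par P Q => P.Over p q ∧ Q.Over p q
  | choice _ P Q => P.Over p q ∧ Q.Over p q
  | nondet P Q => P.Over p q ∧ Q.Over p q
  | ite b P Q => q b ∧ P.Over p q ∧ Q.Over p q
  | whileDo b P => q b ∧ P.Over p q

theorem Prog.Over.mono {p p' : A → Prop} {q q' : B → Prop} (hp : ∀ a, p a → p' a)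
    (hq : ∀ b, q b → q' b) {P : Prog A B} (h : P.Over p q) : P.Over p' q' := by
  induction P with
  | skip => trivial
  | atom a => exact hp a h
  | seq P Q hP hQ | par P Q hP hQ | choice _ P Q hP hQ | nondet P Q hP hQ =>
    exact ⟨hP h.1, hQ h.2⟩
  | ite b P Q hP hQ => exact ⟨hq b h.1, hP h.2.1, hQ h.2.2⟩
  | whileDo b P hP => exact ⟨hq b h.1, hP h.2⟩

/-- Only finitely many atomic programs and conditions occur in a program, which is why pointwise
computability suffices for a fixed one. -/
theorem Prog.exists_over (P : Prog A B) :
    ∃ (K : List A) (L : List B), P.Over (· ∈ K) (· ∈ L) := by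
  induction P with
  | skip => exact ⟨[], [], trivial⟩
  | atom a => exact ⟨[a], [], List.mem_singleton_self a⟩
  | seq P Q hP hQ | par P Q hP hQ | choice _ P Q hP hQ | nondet P Q hP hQ =>
    obtain ⟨K, L, hP⟩ := hP
    obtain ⟨K', L', hQ⟩ := hQ
    exact ⟨K ++ K', L ++ L',
      hP.mono (fun _ => List.mem_append_left _) (fun _ => List.mem_append_left _),
      hQ.mono (fun _ => List.mem_append_right _) (fun _ => List.mem_append_right _)⟩
  | ite b P Q hP hQ =>
    obtain ⟨K, L, hP⟩ := hP
    obtain ⟨K', L', hQ⟩ := hQ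
    exact ⟨K ++ K', b :: (L ++ L'), List.mem_cons_self,
      hP.mono (fun _ => List.mem_append_left _)
        (fun _ h => List.mem_cons_of_mem _ (List.mem_append_left _ h)),
      hQ.mono (fun _ => List.mem_append_right _)
        (fun _ h => List.mem_cons_of_mem _ (List.mem_append_right _ h))⟩
  | whileDo b P hP =>
    obtain ⟨K, L, hP⟩ := hP
    exact ⟨K, b :: L, List.mem_cons_self,
      hP.mono (fun _ h => h) (fun _ h => List.mem_cons_of_mem _ h)⟩

variable {I I' : Interp A B S} {p : A → Prop} {q : B → Prop}

theorem Step.congr (hp : ∀ a, p a → I.atom a = I'.atom a) (hq : ∀ b, q b → I.cond b = I'.cond b)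
    {c : Config A B S} {ν : PVal (Outcome A B S)} (h : Step I c ν) (hc : c.1.Over p q) :
    Step I' c ν := by
  induction h with
  | skip s => exact .skip s
  | atom a s => rw [hp a hc]; exact .atom a s
  | seq _ ih => exact .seq (ih hc.1)
  | parLeft _ ih => exact .parLeft (ih hc.1)
  | parRight _ ih => exact .parRight (ih hc.2)
  | choice _ _ ihP ihQ => exact .choice (ihP hc.1) (ihQ hc.2)
  | nondetLeft _ ih => exact .nondetLeft (ih hc.1)
  | nondetRight _ ih => exact .nondetRight (ih hc.2)
  | iteTrue h => exact .iteTrue (by rw [← hq _ hc.1, h])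
  | iteFalse h => exact .iteFalse (by rw [← hq _ hc.1, h])
  | whileTrue h => exact .whileTrue (by rw [← hq _ hc.1, h])
  | whileFalse h => exact .whileFalse (by rw [← hq _ hc.1, h])

theorem PVal.exists_of_mem_support_map {X Y : Type*} {f : X → Y} {μ : PVal X} {y : Y}
    (h : y ∈ (μ.map f).1.support) : ∃ x ∈ μ.1.support, f x = y := by
  classical
  exact Finset.mem_image.1 (Finsupp.mapDomain_support h)

theorem PVal.eq_of_mem_support_dirac {X : Type*} {x y : X} (h : x ∈ (PVal.dirac y).1.support) :
    x = y := by
  rwa [PVal.support_dirac, Finset.mem_singleton] at h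

theorem over_of_mem_support_continue {k : Prog A B → Prog A B} {Q : Prog A B}
    {ν : PVal (Outcome A B S)} (hk : ∀ P, P.Over p q → (k P).Over p q) (hQ : Q.Over p q)
    (hν : ∀ c, Sum.inr c ∈ ν.1.support → c.1.Over p q) {c : Config A B S}
    (hc : Sum.inr c ∈ (ν.map (Outcome.continue k Q)).1.support) : c.1.Over p q := by
  obtain ⟨t | d, ho, h⟩ := PVal.exists_of_mem_support_map hc
  · cases h
    exact hQ
  · cases h
    exact hk _ (hν d ho)

/-- Steps only rearrange pieces of the program, or unfold a loop into its body followed by the loop.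
The restriction therefore persists along a whole run. -/
theorem Step.over {c : Config A B S} {ν : PVal (Outcome A B S)} (h : Step I c ν)
    (hc : c.1.Over p q) (c' : Config A B S) (hc' : Sum.inr c' ∈ ν.1.support) :
    c'.1.Over p q := by
  induction h generalizing c' with
  | skip s => cases PVal.eq_of_mem_support_dirac hc'
  | atom a s =>
    obtain ⟨_, _, h⟩ := PVal.exists_of_mem_support_map hc'
    cases h
  | @seq P Q _ _ _ ih =>
    exact over_of_mem_support_continue (k := fun P' => .seq P' Q) (fun _ h => ⟨h, hc.2⟩) hc.2
      (ih hc.1) hc'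
  | @parLeft P Q _ _ _ ih =>
    exact over_of_mem_support_continue (k := fun P' => .par P' Q) (fun _ h => ⟨h, hc.2⟩) hc.2
      (ih hc.1) hc'
  | @parRight P Q _ _ _ ih =>
    exact over_of_mem_support_continue (k := fun Q' => .par P Q') (fun _ h => ⟨hc.1, h⟩) hc.1
      (ih hc.2) hc'
  | choice _ _ ihP ihQ =>
    classical
    rcases Finset.mem_union.1 (Finsupp.support_add hc') with h | h
    · exact ihP hc.1 c' (Finsupp.support_smul h)
    · exact ihQ hc.2 c' (Finsupp.support_smul h)
  | nondetLeft _ ih => exact ih hc.1 c' hc'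
  | nondetRight _ ih => exact ih hc.2 c' hc'
  | iteTrue h => cases PVal.eq_of_mem_support_dirac hc'; exact hc.2.1
  | iteFalse h => cases PVal.eq_of_mem_support_dirac hc'; exact hc.2.2
  | whileTrue h => cases PVal.eq_of_mem_support_dirac hc'; exact ⟨hc.2, hc⟩
  | whileFalse h => cases PVal.eq_of_mem_support_dirac hc'

theorem approx_subset (hp : ∀ a, p a → I.atom a = I'.atom a)
    (hq : ∀ b, q b → I.cond b = I'.cond b) (n : ℕ) (c : Config A B S) (hc : c.1.Over p q) :
    approx I n c ⊆ approx I' n c := by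
  induction n generalizing c with
  | zero => exact subset_rfl
  | succ n ih =>
    rintro _ ⟨ν, hν, m, hm, rfl⟩
    exact ⟨ν, hν.congr hp hq hc, m, fun c' hc' => ih c' (hν.over hc c' hc') (hm c' hc'), rfl⟩

/-- The exhaustive search depends only on the interpretation of the atomic programs and conditions
of the program. -/
theorem approx_congr (hp : ∀ a, p a → I.atom a = I'.atom a)
    (hq : ∀ b, q b → I.cond b = I'.cond b) (n : ℕ) (c : Config A B S) (hc : c.1.Over p q) :
    approx I n c = approx I' n c :=
  (approx_subset hp hq n c hc).antisymm
    (approx_subset (fun a h => (hp a h).symm) (fun b h => (hq b h).symm) n c hc)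

/-- Finitely many unrelated algorithms merge by comparing the argument with each entry of `L`;
outside `L` the common default takes over. -/
theorem computable_ite_mem_list {X Y : Type*} [Primcodable A] [Primcodable X] [Primcodable Y]
    [DecidableEq A] {f : A → X → Y} {d : X → Y} (hf : ∀ a, Computable (f a)) (hd : Computable d)
    (L : List A) : ∃ F : A × X → Y, Computable F ∧
      ∀ a x, F (a, x) = if a ∈ L then f a x else d x := by
  induction L with
  | nil => exact ⟨fun x => d x.2, hd.comp Computable.snd, fun _ _ => by simp⟩
  | cons b L ih =>
    obtain ⟨F, hF, h⟩ := ih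
    refine ⟨fun x => bif decide (x.1 = b) then f b x.2 else F x,
      Computable.cond (Primrec.eq.decide.to_comp.comp Computable.fst (Computable.const b))
        ((hf b).comp Computable.snd) hF, fun a x => ?_⟩
    by_cases hab : a = b <;> simp [hab, h]

variable [Primcodable A] [Primcodable B] [Primcodable S]

/-- The exhaustive search for a fixed program is computable if each atomic program and each
condition is. -/
theorem computableFin_approx_prog (I : Interp A B S) (hatom : ∀ a, ComputableVal (I.atom a))
    (hcond : ∀ b, Computable (I.cond b)) (P : Prog A B) :
    ComputableFin fun x : ℕ × S => approx I x.1 (P, x.2) := by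
  let _ : DecidableEq A := Encodable.decidableEqOfEncodable A
  let _ : DecidableEq B := Encodable.decidableEqOfEncodable B
  obtain ⟨K, L, hP⟩ := P.exists_over
  choose g hg hgI using hatom
  have hd : Computable fun s : S => [(s, (1 : ℚ≥0))] :=
    Computable.list_cons.comp (Computable.id.pair (Computable.const 1)) (Computable.const [])
  obtain ⟨F, hF, hFg⟩ := computable_ite_mem_list hg hd K
  obtain ⟨G, hG, hGI⟩ := computable_ite_mem_list hcond (Computable.const false) L
  -- `J` agrees with `I` on everything occurring in `P` and is trivial elsewhere, which makes it
  -- uniformly computable.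
  let J : Interp A B S :=
    { atom := fun a s => if a ∈ K then I.atom a s else PVal.dirac s
      cond := fun b s => if b ∈ L then I.cond b s else false }
  have hJ : ComputableFin fun x : ℕ × Config A B S => approx J x.1 x.2 := by
    refine computableFin_approx ⟨F, hF, fun x => ?_⟩ (hG.of_eq fun x => hGI x.1 x.2)
    change (if x.1 ∈ K then I.atom x.1 x.2 else PVal.dirac x.2).1 = ofList (F (x.1, x.2))
    rw [hFg]
    split_ifs
    · exact hgI _ _
    · exact (ofList_single _).symm
  obtain ⟨l, hl, hlJ⟩ := hJ
  refine ⟨fun x => l (x.1, P, x.2), hl.comp (Computable.fst.pair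
    ((Computable.const P).pair Computable.snd)), fun x => ?_⟩
  rw [← hlJ]
  refine approx_congr (p := (· ∈ K)) (q := (· ∈ L)) (fun a ha => ?_) (fun b hb => ?_) _ _ hP
  · funext s
    exact (if_pos ha).symm
  · funext s
    exact (if_pos hb).symm

end Restrict

/-! ### Semi-decidability -/

/-- Each test terminates, so the unbounded search halts exactly when some test succeeds. -/
theorem rePred_exists_nat {X : Type*} [Primcodable X] {f : X → ℕ → Bool} (hf : Computable₂ f) :
    REPred fun x => ∃ n, f x n = true := by
  refine (Partrec.dom_re (Partrec.rfind (p := fun x n => Part.some (f x n))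
    hf.partrec₂)).of_eq fun x => (Nat.rfind_dom (p := fun n => Part.some (f x n))).trans <|
      exists_congr fun n => ⟨fun h => (Part.mem_some_iff.1 h.1).symm,
        fun h => ⟨Part.mem_some_iff.2 h.symm, fun _ => trivial⟩⟩

/-! ### Deciding statistical formulas on listed valuations -/

section Formulas

variable {A B S X ι : Type*}

/-- Decide whether the valuation denoted by a list satisfies `(> q.2) (U q.1)`, where `u` decides
membership in the sets `U i`. -/
def holds (u : ι × S → Bool) (q : ι × ℚ≥0) (l : List (S × ℚ≥0)) : Bool :=
  decide (q.2 < (l.map fun x => bif u (q.1, x.1) then x.2 else 0).sum)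

theorem holds_iff {u : ι × S → Bool} {U : ι → Set S} (hu : ∀ i s, u (i, s) = true ↔ s ∈ U i)
    (q : ι × ℚ≥0) (l : List (S × ℚ≥0)) :
    holds u q l = true ↔ ofList l ∈ stat (q.2 : ℝ≥0) (U q.1) := by
  classical
  have h : mass (ofList l) (U q.1) =
      (((l.map fun x => bif u (q.1, x.1) then x.2 else 0).sum : ℚ≥0) : ℝ≥0) := by
    induction l with
    | nil => simp [ofList_nil, mass_zero]
    | cons x l ih =>
      rw [ofList_cons, mass_add, ih, List.map_cons, List.sum_cons, NNRat.cast_add, mass,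
        Finsupp.sum_single_index (by by_cases hx : x.1 ∈ U q.1 <;> simp [hx])]
      congr 1
      by_cases hx : x.1 ∈ U q.1
      · rw [Set.indicator_of_mem hx, (hu _ _).2 hx, cond_true]
      · rw [Set.indicator_of_notMem hx, Bool.eq_false_iff.2 (mt (hu _ _).1 hx), cond_false,
          NNRat.cast_zero]
  rw [holds, decide_eq_true_eq, stat, Set.mem_ofPred_eq, h, NNRat.cast_lt]

variable [Primcodable S] [Primcodable X] [Primcodable ι]

theorem computable_holds {u : ι × S → Bool} (hu : Computable u) : Computable₂ (holds u) := by
  have h1 : Computable₂ fun (y : (ι × ℚ≥0) × List (S × ℚ≥0)) (x : S × ℚ≥0) =>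
      bif u (y.1.1, x.1) then x.2 else 0 :=
    Computable.cond (hu.comp ((Computable.fst.comp (Computable.fst.comp Computable.fst)).pair
      (Computable.fst.comp Computable.snd))) (Computable.snd.comp Computable.snd)
      (Computable.const 0)
  have h2 : Computable fun y : (ι × ℚ≥0) × List (S × ℚ≥0) =>
      (y.2.map fun x => bif u (y.1.1, x.1) then x.2 else 0).sum :=
    Computable.list_sum_map Computable.snd h1 primrec_nnrat_add.to_comp
  have h3 : Computable₂ fun p q : ℚ≥0 => decide (p < q) := primrec_nnrat_lt.decide.to_comp
  exact h3.comp (Computable.snd.comp Computable.fst) h2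

/-- Satisfaction of a statistical formula is semi-decidable if the exhaustive search is
computable. -/
theorem rePred_sat {I : Interp A B S} {c : X → Config A B S} {Φ : X → List (ι × ℚ≥0)}
    {U : ι → Set S} (hF : ComputableFin fun x : ℕ × X => approx I x.1 (c x.2))
    (hΦ : Computable Φ) (hU : ComputablePred fun x : ι × S => x.2 ∈ U x.1) :
    REPred (fun x => SatMay I (c x) (⋃ q ∈ Φ x, stat (q.2 : ℝ≥0) (U q.1))) ∧
    REPred (fun x => SatMust I (c x) (⋂ q ∈ Φ x, stat (q.2 : ℝ≥0) (U q.1))) := by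
  obtain ⟨g, hg, hgF⟩ := hF
  obtain ⟨_, hu⟩ := hU
  let u : ι × S → Bool := fun x => decide (x.2 ∈ U x.1)
  have hhold := computable_holds hu
  have hholds : ∀ q l, holds u q l = true ↔ ofList l ∈ stat (q.2 : ℝ≥0) (U q.1) :=
    holds_iff fun i s => decide_eq_true_iff
  have hg' : Computable fun y : X × ℕ => g (y.2, y.1) :=
    hg.comp (Computable.snd.pair Computable.fst)
  have hq : Computable₂ fun (z : (X × ℕ) × List (S × ℚ≥0)) (q : ι × ℚ≥0) => holds u q z.2 :=
    hhold.comp Computable.snd (Computable.snd.comp Computable.fst)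
  have hΦ' : Computable fun z : (X × ℕ) × List (S × ℚ≥0) => Φ z.1.1 :=
    hΦ.comp (Computable.fst.comp Computable.fst)
  have hany : Computable₂ fun (x : X) (n : ℕ) =>
      (g (n, x)).any fun l => (Φ x).any fun q => holds u q l := by
    have h : Computable₂ fun (y : X × ℕ) (l : List (S × ℚ≥0)) =>
        (Φ y.1).any fun q => holds u q l := Computable.list_any hΦ' hq
    exact Computable.list_any hg' h
  have hall : Computable₂ fun (x : X) (n : ℕ) =>
      (g (n, x)).all fun l => (Φ x).all fun q => holds u q l := by
    have h : Computable₂ fun (y : X × ℕ) (l : List (S × ℚ≥0)) =>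
        (Φ y.1).all fun q => holds u q l := Computable.list_all hΦ' hq
    exact Computable.list_all hg' h
  have happrox : ∀ n x, approx I n (c x) = {μ | ∃ l ∈ g (n, x), μ = ofList l} :=
    fun n x => hgF (n, x)
  constructor
  · refine (rePred_exists_nat hany).of_eq fun x => ?_
    -- The finite list becomes an index type, to which the criterion for indexed families applies.
    have hφ : (⋃ q ∈ Φ x, stat (q.2 : ℝ≥0) (U q.1)) =
        ⋃ q : {q // q ∈ Φ x}, stat (q.1.2 : ℝ≥0) (U q.1.1) := by
      ext μ
      simp
    rw [hφ, satMay_iff]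
    refine exists_congr fun n => ?_
    rw [happrox]
    simp only [List.any_eq_true, hholds, Set.mem_ofPred_eq, Set.mem_iUnion, Subtype.exists,
      exists_prop]
    constructor
    · rintro ⟨l, hl, q, hq, h⟩
      exact ⟨_, ⟨l, hl, rfl⟩, q, hq, h⟩
    · rintro ⟨_, ⟨l, hl, rfl⟩, q, hq, h⟩
      exact ⟨l, hl, q, hq, h⟩
  · refine (rePred_exists_nat hall).of_eq fun x => ?_
    have hφ : (⋂ q ∈ Φ x, stat (q.2 : ℝ≥0) (U q.1)) =
        ⋂ q : {q // q ∈ Φ x}, stat (q.1.2 : ℝ≥0) (U q.1.1) := by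
      ext μ
      simp
    rw [hφ, satMust_iff]
    refine exists_congr fun n => ?_
    rw [happrox]
    simp only [List.all_eq_true, hholds, Set.mem_ofPred_eq, Set.mem_iInter, Subtype.forall]
    constructor
    · rintro h _ ⟨l, hl, rfl⟩ q hq
      exact h l hl q hq
    · intro h l hl q hq
      exact h _ ⟨l, hl, rfl⟩ q hq

theorem ComputableFin.comp {Y : Type*} [Primcodable Y] {F : X → Set (S →₀ ℝ≥0)}
    (hF : ComputableFin F) {f : Y → X} (hf : Computable f) : ComputableFin fun y => F (f y) := by
  obtain ⟨g, hg, hgF⟩ := hF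
  exact ⟨fun y => g (f y), hg.comp hf, fun y => hgF (f y)⟩

/-- The case of `rePred_sat` for a single threshold. -/
theorem rePred_sat_single {I : Interp A B S} {c : X → Config A B S} {i : X → ι} {p : X → ℚ≥0}
    {U : ι → Set S} (hF : ComputableFin fun x : ℕ × X => approx I x.1 (c x.2))
    (hi : Computable i) (hp : Computable p)
    (hU : ComputablePred fun x : ι × S => x.2 ∈ U x.1) :
    REPred (fun x => SatMay I (c x) (stat (p x : ℝ≥0) (U (i x)))) ∧
    REPred (fun x => SatMust I (c x) (stat (p x : ℝ≥0) (U (i x)))) := by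
  have h := rePred_sat hF (Φ := fun x => [(i x, p x)])
    (Computable.list_cons.comp (hi.pair hp) (Computable.const [])) hU
  simpa using h

/-- The case of `rePred_sat` for a fixed number of thresholds. -/
theorem rePred_sat_fin {I : Interp A B S} {c : X → Config A B S} {k : ℕ} {p : X → Fin k → ℚ≥0}
    {U : Fin k → Set S} (hF : ComputableFin fun x : ℕ × X => approx I x.1 (c x.2))
    (hp : Computable p) (hU : ∀ i, ComputablePred fun s => s ∈ U i) :
    REPred (fun x => SatMay I (c x) (⋃ i, stat (p x i : ℝ≥0) (U i))) ∧
    REPred (fun x => SatMust I (c x) (⋂ i, stat (p x i : ℝ≥0) (U i))) := by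
  classical
  have hΦ : Computable fun x => List.ofFn fun i => (i, p x i) := Computable.list_ofFn fun i =>
    (Computable.const i).pair (Computable.fin_app.comp hp (Computable.const i))
  -- There are finitely many sets, so their separate decision procedures form a uniform one.
  have hU' : ComputablePred fun x : Fin k × S => x.2 ∈ U x.1 :=
    ⟨inferInstance, Computable.finCasesOn (f := fun i s => decide (s ∈ U i)) fun i =>
      (hU i).decide⟩
  have h := rePred_sat hF hΦ hU'
  refine ⟨h.1.of_eq fun x => ?_, h.2.of_eq fun x => ?_⟩
  · have : (⋃ q ∈ List.ofFn fun i => (i, p x i), stat (q.2 : ℝ≥0) (U q.1)) =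
        ⋃ i, stat (p x i : ℝ≥0) (U i) := by
      ext μ
      simp [List.mem_ofFn]
    rw [this]
  · have : (⋂ q ∈ List.ofFn fun i => (i, p x i), stat (q.2 : ℝ≥0) (U q.1)) =
        ⋂ i, stat (p x i : ℝ≥0) (U i) := by
      ext μ
      simp [List.mem_ofFn]
    rw [this]

end Formulas

end PGCL

/-! ### The main theorem -/

theorem mainTheorem5 {A B S : Type*} [Primcodable A] [Primcodable B] [Primcodable S]
    (I : PGCL.Interp A B S)
    (hatom : ∀ a, PGCL.ComputableVal (I.atom a))
    (hcond : ∀ b, Computable (I.cond b)) :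
    -- correctness and completeness of the exhaustive search through the sets `Fₙ`
    (∀ (c : PGCL.Config A B S) (k : ℕ) (p : Fin k → ℚ≥0) (U : Fin k → Set S),
      (PGCL.SatMay I c (⋃ i, PGCL.stat (p i) (U i)) ↔
        ∃ n, ∃ μ ∈ PGCL.approx I n c, μ ∈ ⋃ i, PGCL.stat (p i : ℝ≥0) (U i)) ∧
      (PGCL.SatMust I c (⋂ i, PGCL.stat (p i) (U i)) ↔
        ∃ n, ∀ μ ∈ PGCL.approx I n c, μ ∈ ⋂ i, PGCL.stat (p i : ℝ≥0) (U i))) ∧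
    -- for each program: semi-decidability in the initial state and the thresholds
    (∀ P : PGCL.Prog A B,
      PGCL.ComputableFin (fun x : ℕ × S => PGCL.approx I x.1 (P, x.2)) ∧
      (∀ U : Set S, ComputablePred (fun s => s ∈ U) →
        REPred (fun x : S × ℚ≥0 => PGCL.SatMay I (P, x.1) (PGCL.stat x.2 U)) ∧
        REPred (fun x : S × ℚ≥0 => PGCL.SatMust I (P, x.1) (PGCL.stat x.2 U))) ∧
      (∀ (k : ℕ) (U : Fin k → Set S), (∀ i, ComputablePred (fun s => s ∈ U i)) →
        REPred (fun x : S × (Fin k → ℚ≥0) =>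
          PGCL.SatMay I (P, x.1) (⋃ i, PGCL.stat (x.2 i) (U i))) ∧
        REPred (fun x : S × (Fin k → ℚ≥0) =>
          PGCL.SatMust I (P, x.1) (⋂ i, PGCL.stat (x.2 i) (U i))))) ∧
    -- if the interpretations are computable uniformly in the atomic program and the condition:
    -- semi-decidability also uniformly in the program and the formula
    (PGCL.ComputableVal (fun x : A × S => I.atom x.1 x.2) →
      Computable (fun x : B × S => I.cond x.1 x.2) →
      PGCL.ComputableFin (fun x : ℕ × PGCL.Config A B S => PGCL.approx I x.1 x.2) ∧
      ∀ (ι : Type) [Primcodable ι] (U : ι → Set S),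
        ComputablePred (fun x : ι × S => x.2 ∈ U x.1) →
        REPred (fun x : PGCL.Config A B S × ι × ℚ≥0 =>
          PGCL.SatMay I x.1 (PGCL.stat x.2.2 (U x.2.1))) ∧
        REPred (fun x : PGCL.Config A B S × ι × ℚ≥0 =>
          PGCL.SatMust I x.1 (PGCL.stat x.2.2 (U x.2.1))) ∧
        REPred (fun x : PGCL.Config A B S × List (ι × ℚ≥0) =>
          PGCL.SatMay I x.1 (⋃ q ∈ x.2, PGCL.stat q.2 (U q.1))) ∧
        REPred (fun x : PGCL.Config A B S × List (ι × ℚ≥0) =>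
          PGCL.SatMust I x.1 (⋂ q ∈ x.2, PGCL.stat q.2 (U q.1)))) := by
  refine ⟨fun c k p U => ⟨PGCL.satMay_iff I c _ U, PGCL.satMust_iff I c _ U⟩, fun P => ?_,
    fun hatom' hcond' => ?_⟩
  · have hF := PGCL.computableFin_approx_prog I hatom hcond P
    refine ⟨hF, fun U hU => ?_, fun k U hU => ?_⟩
    · have hF' := hF.comp (f := fun x : ℕ × S × ℚ≥0 => (x.1, x.2.1))
        (Computable.fst.pair (Computable.fst.comp Computable.snd))
      -- A single set is treated as a family indexed by `Unit`.
      have hU' : ComputablePred fun x : Unit × S => x.2 ∈ U := by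
        obtain ⟨_, hU⟩ := hU
        exact ⟨inferInstance, hU.comp Computable.snd⟩
      exact PGCL.rePred_sat_single (c := fun x : S × ℚ≥0 => (P, x.1)) (U := fun _ : Unit => U) hF'
        (Computable.const ()) Computable.snd hU'
    · have hF' := hF.comp (f := fun x : ℕ × S × (Fin k → ℚ≥0) => (x.1, x.2.1))
        (Computable.fst.pair (Computable.fst.comp Computable.snd))
      exact PGCL.rePred_sat_fin (c := fun x : S × (Fin k → ℚ≥0) => (P, x.1)) hF'
        Computable.snd hU
  · have hF := PGCL.computableFin_approx hatom' hcond'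
    refine ⟨hF, fun ι _ U hU => ?_⟩
    have hF1 := hF.comp (f := fun x : ℕ × PGCL.Config A B S × ι × ℚ≥0 => (x.1, x.2.1))
      (Computable.fst.pair (Computable.fst.comp Computable.snd))
    have hF2 := hF.comp (f := fun x : ℕ × PGCL.Config A B S × List (ι × ℚ≥0) => (x.1, x.2.1))
      (Computable.fst.pair (Computable.fst.comp Computable.snd))
    have h1 := PGCL.rePred_sat_single (c := fun x : PGCL.Config A B S × ι × ℚ≥0 => x.1) hF1
      (Computable.fst.comp Computable.snd) (Computable.snd.comp Computable.snd) hU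
    have h2 := PGCL.rePred_sat (c := fun x : PGCL.Config A B S × List (ι × ℚ≥0) => x.1) hF2
      Computable.snd hU
    exact ⟨h1.1, h1.2, h2.1, h2.2⟩
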